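/- **Setting.** Fix integers $M\ge 1$, $d\ge 0$, a sequence of (non-random) prompt covariates $x_1,x_2,\dots\in\mathbb R^d$ and probabilities $p_{(i,j)}$, $(i,j)\in[M]^2$. Write $\tilde\beta=(\beta_{01},\dots,\beta_{0M},\beta_1^\top,\dots,\beta_M^\top)^\top\in\mathbb R^{M+Md}$, $\theta_m(x)=\beta_{0m}+x^\top\beta_m$, and $$\Theta=\Big\{\tilde\beta:\ \sum_{m}\beta_{0m}=0,\ \sum_m\beta_m=0\Big\}=\{\tilde\beta: C\tilde\beta=0\},\qquad \mathcal P=I-C^\top(CC^\top)^{-1}C ,$$ where $C$ is the matrix of these $1+d$ linear constraints. Let $\tilde\beta^*\in\Theta$. The comparisons $(a_l,y_l)$, $l\ge1$, are independent, with $a_l=(i,j)$ with probability $p_{(i,j)}$ and $y_l\in\{0,1\}$, $$\mathbb P(y_l=1\mid a_l=(i,j))=\frac{e^{\theta^*_j(x_l)}}{e^{\theta^*_j(x_l)}+e^{\theta^*_i(x_l)}},$$ $\theta^*_m$ being the utilities with coefficients $\tilde\beta^*$. Put $\tilde x_{l,(i,j)}=(e_j,e_j\otimes x_l)-(e_i,e_i\otimes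 x_l)$, $\tilde x_{a_l}=\tilde x_{l,a_l}$, $\sigma(z)=(1+e^{-z})^{-1}$, $$\ell_L(\tilde\beta)=-\sum_{l=1}^L\big[y_l\log\sigma(\tilde\beta^\top\tilde x_{a_l})+(1-y_l)\log(1-\sigma(\tilde\beta^\top\tilde x_{a_l}))\big],$$ $$\mathcal I_L(\tilde\beta)=\sum_{l=1}^L\sum_{a}p_a\,\sigma(\tilde\beta^\top\tilde x_{l,a})(1-\sigma(\tilde\beta^\top\tilde x_{l,a}))\,\tilde x_{l,a}\tilde x_{l,a}^\top .$$ Let $\hat\beta_L$ be a random vector that is a minimizer of $\ell_L$ over $\Theta$ (a constrained MLE) whenever such a minimizer exists, and arbitrary otherwise. **Assumptions.** 1. The graph on $[M]$ joining $i\ne j$ whenever $p_{(i,j)}>0$ or $p_{(j,i)}>0$ is connected. 2. Almost surely, for all large $L$, the matrix $\bar X_L$ with rows $(e_j\otimes x_l-e_i\otimes x_l)^\top$, $a_l=(i,j)$, $l\le L$, has full column rank on the normalized slopes: $\bar X_L v=0$ and $\sum_m v_m=0$ imply $v=0$, for $v=(v_1,\dots,v_M)\in(\mathbb R^d)^M$.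 3. There are finite constants $B_2,B$ with $\|\tilde x_{l,a}\|_2<B_2$ and $|\tilde\beta^{*\top}\tilde x_{l,a}|\le B$ for all $l$ and all $a$ with $p_a>0$. 4. $\frac1L\mathcal I_L(\tilde\beta^*)\to\bar{\mathcal I}$ as $L\to\infty$, where $v^\top\bar{\mathcal I}v>0$ for all $0\neq v\in\Theta$. **Theorem.** Under these assumptions, as $L\to\infty$ with $M$ and $d$ fixed: for all large $L$, $\tilde\beta^*$ is the unique minimizer of $\mathbb E[\ell_L]$ over $\Theta$; with probability tending to one, $\ell_L$ has a unique minimizer over $\Theta$; and $$\sqrt L\,(\hat\beta_L-\tilde\beta^*)\ \xrightarrow{d}\ \mathcal N\big(0,(\mathcal P\bar{\mathcal I}\mathcal P)^\dagger\big),$$ where $\dagger$ denotes the Moore–Penrose pseudoinverse. -/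

import Mathlib

open MeasureTheory ProbabilityTheory Filter
open scoped Topology Matrix

noncomputable section

namespace ContextualBTL

/-- Coordinates of the stacked parameter `(β₀₁, …, β₀M, β₁, …, β_M) ∈ ℝ^(M + M d)`:
`Sum.inl m` is the intercept of item `m`, `Sum.inr (m, k)` is the `k`-th slope of item `m`. -/
abbrev Idx (M d : ℕ) : Type := Fin M ⊕ (Fin M × Fin d)

/-- The stacked parameter space `ℝ^(M + M d)` with its Euclidean norm. -/
abbrev Param (M d : ℕ) : Type := EuclideanSpace ℝ (Idx M d)

/-- Covariate vectors in `ℝ^d`. -/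
abbrev Covariate (d : ℕ) : Type := EuclideanSpace ℝ (Fin d)

variable {M d : ℕ}

/-- The utility `θ_m(x) = β₀ₘ + xᵀ βₘ`. -/
def utility (β : Param M d) (m : Fin M) (x : Covariate d) : ℝ :=
  β (Sum.inl m) + ∑ k, x k * β (Sum.inr (m, k))

/-- The slope part of the design vector of the comparison `a = (i, j)` under the covariate `x`,
`e_j ⊗ x - e_i ⊗ x ∈ ℝ^(M d)`. -/
def slopeDesign (x : Covariate d) (a : Fin M × Fin M) : Fin M × Fin d → ℝ :=
  fun r => ((Pi.single a.2 1 : Fin M → ℝ) r.1 - (Pi.single a.1 1 : Fin M → ℝ) r.1) * x r.2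

/-- The design vector `(e_j, e_j ⊗ x) - (e_i, e_i ⊗ x)` of the comparison `a = (i, j)`. -/
def design (x : Covariate d) (a : Fin M × Fin M) : Param M d :=
  WithLp.toLp 2 (Sum.elim
    (fun m => (Pi.single a.2 1 : Fin M → ℝ) m - (Pi.single a.1 1 : Fin M → ℝ) m)
    (slopeDesign x a))

/-- The constrained parameter space `Θ`: intercepts sum to zero and slope vectors sum to zero. -/
def Theta (M d : ℕ) : Set (Param M d) :=
  {β | ∑ m, β (Sum.inl m) = 0 ∧ ∀ k, ∑ m, β (Sum.inr (m, k)) = 0}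

/-- The matrix `C` of the normalization constraints, so that `Θ = {β | C β = 0}`. -/
def constraintMatrix (M d : ℕ) : Matrix (Unit ⊕ Fin d) (Idx M d) ℝ :=
  Matrix.fromBlocks
    (Matrix.of fun _ _ => 1) 0
    0 (Matrix.of fun k r => if r.2 = k then 1 else 0)

/-- The orthogonal projection `I - Cᵀ (C Cᵀ)⁻¹ C` onto `Θ`. -/
def projMatrix (M d : ℕ) : Matrix (Idx M d) (Idx M d) ℝ :=
  1 - (constraintMatrix M d)ᵀ *
    (constraintMatrix M d * (constraintMatrix M d)ᵀ)⁻¹ * constraintMatrix M d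

/-- `B` is the Moore–Penrose pseudoinverse of the real matrix `A` (the four Penrose equations). -/
structure IsMoorePenroseInverse {m n : Type*} [Fintype m] [Fintype n]
    (A : Matrix m n ℝ) (B : Matrix n m ℝ) : Prop where
  mul_mul_self : A * B * A = A
  self_mul_mul : B * A * B = B
  symm_left : (A * B)ᵀ = A * B
  symm_right : (B * A)ᵀ = B * A

/-- The negative log-likelihood of the first `L` comparisons `a l = (i, j)` with outcomes `y l`
(`true` when `j` is preferred to `i`) and covariates `x l`. -/
def negLogLik (x : ℕ → Covariate d) (a : ℕ → Fin M × Fin M) (y : ℕ → Bool) (L : ℕ)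
    (β : Param M d) : ℝ :=
  ∑ l ∈ Finset.range L,
    -((if y l then 1 else 0) * Real.log (Real.sigmoid (inner ℝ β (design (x l) (a l)))) +
      (1 - (if y l then 1 else 0)) *
        Real.log (1 - Real.sigmoid (inner ℝ β (design (x l) (a l)))))

/-- `β` minimizes the negative log-likelihood of the first `L` comparisons over `Θ`. -/
def IsConstrainedMLE (x : ℕ → Covariate d) (a : ℕ → Fin M × Fin M) (y : ℕ → Bool) (L : ℕ)
    (β : Param M d) : Prop :=
  β ∈ Theta M d ∧ IsMinOn (negLogLik x a y L) (Theta M d) β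

/-- The contextual BTL sampling model with parameter `β`, prompt covariates `x l` and pair
probabilities `p`: the `(a l, y l)` are independent, `a l = (i, j)` with probability `p (i, j)`,
and given `a l = (i, j)`, item `j` is preferred (`y l = true`) with probability
`exp θ_j(x l) / (exp θ_j(x l) + exp θ_i(x l))`. -/
structure IsBTLSample {Ω : Type*} [MeasurableSpace Ω] (P : Measure Ω)
    (x : ℕ → Covariate d) (p : Fin M × Fin M → ℝ) (β : Param M d)
    (a : ℕ → Ω → Fin M × Fin M) (y : ℕ → Ω → Bool) : Prop where
  measurable_pair : ∀ l, Measurable (a l)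
  measurable_outcome : ∀ l, Measurable (y l)
  indep : iIndepFun (fun l ω => (a l ω, y l ω)) P
  pair_prob : ∀ l i j, P.real {ω | a l ω = (i, j)} = p (i, j)
  outcome_prob : ∀ l i j, P.real {ω | a l ω = (i, j) ∧ y l ω = true} =
    p (i, j) * (Real.exp (utility β j (x l)) /
      (Real.exp (utility β j (x l)) + Real.exp (utility β i (x l))))

/-- The comparison graph: distinct items are adjacent when they are compared, in one order or the
other, with positive probability. -/
def comparisonGraph (p : Fin M × Fin M → ℝ) : SimpleGraph (Fin M) :=
  SimpleGraph.fromRel fun i j => 0 < p (i, j)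

/-- The matrix whose rows are the slope parts of the design vectors of the first `L`
comparisons. -/
def slopeDesignMatrix (x : ℕ → Covariate d) (a : ℕ → Fin M × Fin M) (L : ℕ) :
    Matrix (Fin L) (Fin M × Fin d) ℝ :=
  Matrix.of fun l => slopeDesign (x l) (a l)

/-- The columns of a matrix with `M d` columns are as independent as the normalization allows:
no nonzero slope vector with `∑ m, β_m = 0` lies in the kernel. (Each row `e_j ⊗ x - e_i ⊗ x`
annihilates the slope vectors that are equal across items.) -/
def FullColumnRankOnTheta {L : ℕ} (X : Matrix (Fin L) (Fin M × Fin d) ℝ) : Prop :=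
  ∀ v : Fin M × Fin d → ℝ, (∀ k, ∑ m, v (m, k) = 0) → X *ᵥ v = 0 → v = 0

/-- The Fisher information of the first `L` comparisons. -/
def fisherInfo (x : ℕ → Covariate d) (p : Fin M × Fin M → ℝ) (L : ℕ) (β : Param M d) :
    Matrix (Idx M d) (Idx M d) ℝ :=
  ∑ l ∈ Finset.range L, ∑ a : Fin M × Fin M,
    (p a * (Real.sigmoid (inner ℝ β (design (x l) a)) *
      (1 - Real.sigmoid (inner ℝ β (design (x l) a))))) •
        Matrix.vecMulVec (design (x l) a).ofLp (design (x l) a).ofLp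

/-- Positive definiteness of a quadratic form on `Θ`. -/
def PosDefOnTheta (I : Matrix (Idx M d) (Idx M d) ℝ) : Prop :=
  ∀ v ∈ Theta M d, v ≠ 0 → 0 < v.ofLp ⬝ᵥ (I *ᵥ v.ofLp)

end ContextualBTL

end

open ContextualBTL

/-! ### Scalar inequalities for the softplus function and the sigmoid. -/

namespace ContextualBTL

/-! The model is a logistic regression: `negLogLik` is a sum of terms `softplus z - y z`, convex in
the parameter. The proof separates deterministic analysis from probability. Write `A` for the
limiting information, `U` for the score at the truth divided by `√L`, and `S` for the pseudoinverse
of the projected `A`.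

Deterministic part: suppose `‖U‖ ≤ R` and the observed information divided by `L` is entrywise
within a small `δ` of `A`. A quadratic lower bound for the loss near the truth
(`logisticLoss_add_ge`), extended to all of `Θ` by convexity, confines every point with loss at most
that of the truth to a ball of radius of order `1/√L` (`norm_le_of_logisticLoss_le`). A minimizer
therefore exists, and strict convexity makes it unique. Its score vanishes along `Θ`; Taylor
expansion turns this into an approximate linear equation for the rescaled error, which `S` inverts,
so that the error equals `S U` up to terms small in `1/√L` and `δ`
(`norm_sub_pseudoinverse_mulVec_score_le`).

Probabilistic part: Chebyshev's inequality shows that this event has probability close to one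
(`exists_eventually_measure_bad_le`). The score is a sum of independent, centered, bounded terms
with covariance equal to the Fisher information, so a characteristic function argument gives a
Gaussian limit for `S U` with covariance `S A S = S`. Slutsky's theorem transfers the limit to the
estimator.

The population claim is a termwise tangent-line inequality for softplus, strict at some term because
the Fisher information is eventually positive on `Θ`. -/

/-- The softplus function `log (1 + exp z)`, an antiderivative of the sigmoid. -/
noncomputable def softplus (z : ℝ) : ℝ := Real.log (1 + Real.exp z)

lemma hasDerivAt_softplus (z : ℝ) : HasDerivAt softplus (Real.sigmoid z) z := by
  have hpos : (1 + Real.exp z) ≠ 0 := by positivity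
  have h := ((Real.hasDerivAt_exp z).const_add 1).log hpos
  convert! h using 1
  rw [Real.sigmoid_def, Real.exp_neg]
  have := Real.exp_pos z
  field_simp
  ring

lemma continuous_softplus : Continuous softplus :=
  continuous_iff_continuousAt.2 fun z => (hasDerivAt_softplus z).continuousAt

lemma strictConvexOn_softplus : StrictConvexOn ℝ Set.univ softplus := by
  refine StrictMono.strictConvexOn_univ_of_deriv continuous_softplus ?_
  rw [show deriv softplus = Real.sigmoid from funext fun z => (hasDerivAt_softplus z).deriv]
  exact Real.sigmoid_strictMono

/-- The logit link is canonical: `σ(z) = exp z * σ(-z)`, so the response enters only linearly and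
the Hessian of the loss is free of it. -/
lemma bernoulli_negLog_eq (z y : ℝ) :
    -(y * Real.log (Real.sigmoid z) + (1 - y) * Real.log (1 - Real.sigmoid z)) =
      softplus z - y * z := by
  have h1 : ∀ t, Real.log (Real.sigmoid (-t)) = - softplus t := by
    intro t
    rw [Real.sigmoid_def, neg_neg, Real.log_inv, softplus]
  have h2 : Real.log (Real.sigmoid z) = z - softplus z := by
    have : Real.sigmoid z = Real.exp z * Real.sigmoid (-z) := by
      have := Real.sigmoid_mul_rexp_neg (-z)
      rw [neg_neg] at this
      rw [← this]; ring
    rw [this, Real.log_mul (Real.exp_pos z).ne' (Real.sigmoid_pos _).ne', Real.log_exp, h1]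
    ring
  rw [← Real.sigmoid_neg, h1, h2]
  ring

/-- The derivative of the sigmoid. -/
noncomputable def sigmoidDeriv (z : ℝ) : ℝ := Real.sigmoid z * (1 - Real.sigmoid z)

lemma sigmoidDeriv_pos (z : ℝ) : 0 < sigmoidDeriv z :=
  mul_pos (Real.sigmoid_pos z) (sub_pos.2 (Real.sigmoid_lt_one z))

lemma sigmoidDeriv_le_one (z : ℝ) : sigmoidDeriv z ≤ 1 := by
  have h0 := Real.sigmoid_pos z
  have h1 := Real.sigmoid_lt_one z
  unfold sigmoidDeriv
  nlinarith

lemma hasDerivAt_sigmoidDeriv (z : ℝ) :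
    HasDerivAt sigmoidDeriv (sigmoidDeriv z * (1 - 2 * Real.sigmoid z)) z := by
  have h := Real.hasDerivAt_sigmoid z
  convert! h.mul (h.const_sub 1) using 1
  unfold sigmoidDeriv
  ring

lemma abs_sigmoidDeriv_sub_le (z w : ℝ) : |sigmoidDeriv w - sigmoidDeriv z| ≤ |w - z| := by
  have := Convex.norm_image_sub_le_of_norm_hasDerivWithin_le (f := sigmoidDeriv) (C := 1)
    (s := Set.univ) (x := z) (y := w)
    (fun t _ => (hasDerivAt_sigmoidDeriv t).hasDerivWithinAt) ?_ convex_univ trivial trivial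
  · simpa using this
  · intro t _
    have h0 := Real.sigmoid_pos t
    have h1 := Real.sigmoid_lt_one t
    rw [Real.norm_eq_abs, abs_mul, abs_of_pos (sigmoidDeriv_pos t)]
    have : |1 - 2 * Real.sigmoid t| ≤ 1 := abs_le.2 ⟨by linarith, by linarith⟩
    exact mul_le_one₀ (sigmoidDeriv_le_one t) (abs_nonneg _) this

/-- Mean value inequality for `s ↦ σ(z + s) - σ'(z) s`: on the segment its derivative is at most
`|t|`, since `σ'` is 1-Lipschitz. -/
lemma abs_sigmoid_add_sub_le (z t : ℝ) :
    |Real.sigmoid (z + t) - Real.sigmoid z - sigmoidDeriv z * t| ≤ t ^ 2 := by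
  have := Convex.norm_image_sub_le_of_norm_hasDerivWithin_le
    (f := fun s => Real.sigmoid (z + s) - sigmoidDeriv z * s)
    (f' := fun s => sigmoidDeriv (z + s) - sigmoidDeriv z) (C := |t|)
    (s := Set.uIcc 0 t) (x := 0) (y := t) ?_ ?_ (convex_uIcc 0 t) Set.left_mem_uIcc
    Set.right_mem_uIcc
  · simp only [Real.norm_eq_abs, add_zero, mul_zero, sub_zero] at this
    rw [← sq_abs t, sq]
    convert this using 2
    ring
  · intro s _
    have h1 : HasDerivAt (fun s => Real.sigmoid (z + s)) (sigmoidDeriv (z + s)) s :=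
      HasDerivAt.comp_const_add z s (Real.hasDerivAt_sigmoid (z + s))
    have h2 : HasDerivAt (fun s => sigmoidDeriv z * s) (sigmoidDeriv z) s := by
      simpa using (hasDerivAt_id s).const_mul (sigmoidDeriv z)
    exact (h1.sub h2).hasDerivWithinAt
  · intro s hs
    refine (abs_sigmoidDeriv_sub_le z (z + s)).trans ?_
    rw [add_sub_cancel_left]
    simpa using Set.abs_sub_left_of_mem_uIcc hs

/-- An exact increment formula in which `σ'(z)` factors out. It yields lower bounds relative to
`σ'(z)` that are uniform in `z`, which a plain Taylor estimate would not. -/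
lemma sigmoid_add_sub (z t : ℝ) :
    Real.sigmoid (z + t) - Real.sigmoid z =
      sigmoidDeriv z * ((Real.exp t - 1) / (1 + Real.sigmoid z * (Real.exp t - 1))) := by
  unfold sigmoidDeriv
  have hz := Real.exp_pos z
  have ht := Real.exp_pos t
  have h1 : Real.sigmoid z = Real.exp z / (1 + Real.exp z) := by
    rw [Real.sigmoid_def, Real.exp_neg]; field_simp; ring
  have h2 : Real.sigmoid (z + t) = Real.exp z * Real.exp t / (1 + Real.exp z * Real.exp t) := by
    rw [Real.sigmoid_def, Real.exp_neg, Real.exp_add]; field_simp; ring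
  have h3 : 1 + Real.exp z / (1 + Real.exp z) * (Real.exp t - 1) =
      (1 + Real.exp z * Real.exp t) / (1 + Real.exp z) := by
    field_simp; ring
  rw [h1, h2, h3]
  have : 0 < 1 + Real.exp z * Real.exp t := by positivity
  field_simp
  ring

lemma sigmoid_add_sub_ge (z : ℝ) {t : ℝ} (h0 : 0 ≤ t) (h1 : t ≤ 1) :
    sigmoidDeriv z * (t / 2) ≤ Real.sigmoid (z + t) - Real.sigmoid z := by
  rw [sigmoid_add_sub]
  refine mul_le_mul_of_nonneg_left ?_ (sigmoidDeriv_pos z).le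
  have he : t + 1 ≤ Real.exp t := Real.add_one_le_exp t
  have hs0 := Real.sigmoid_pos z
  have hs1 := Real.sigmoid_lt_one z
  have hden : 0 < 1 + Real.sigmoid z * (Real.exp t - 1) := by nlinarith
  rw [le_div_iff₀ hden]
  nlinarith [mul_nonneg h0 (mul_nonneg (sub_nonneg.2 hs1.le) (show 0 ≤ Real.exp t - 1 by linarith)),
    mul_nonneg (sub_nonneg.2 h1) (show 0 ≤ Real.exp t - 1 by linarith)]

lemma sigmoid_sub_sub_ge (z : ℝ) {t : ℝ} (h0 : 0 ≤ t) (h1 : t ≤ 1) :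
    sigmoidDeriv z * (t / 2) ≤ Real.sigmoid z - Real.sigmoid (z - t) := by
  have := sigmoid_add_sub_ge (-z) h0 h1
  rw [show -z + t = -(z - t) by ring, Real.sigmoid_neg, Real.sigmoid_neg] at this
  have h : sigmoidDeriv (-z) = sigmoidDeriv z := by
    unfold sigmoidDeriv; rw [Real.sigmoid_neg]; ring
  rw [h] at this
  linarith

/-- The difference of the two sides, as a function of the increment, decreases on `[-1, 0]` and
increases on `[0, 1]`. The constant `1/4`, half the Taylor coefficient, is the price of uniformity
in `z`. -/
lemma softplus_add_ge (z : ℝ) {t : ℝ} (ht : |t| ≤ 1) :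
    softplus z + Real.sigmoid z * t + sigmoidDeriv z * t ^ 2 / 4 ≤ softplus (z + t) := by
  set h : ℝ → ℝ := fun s => softplus (z + s) - Real.sigmoid z * s - sigmoidDeriv z * s ^ 2 / 4
  have hd : ∀ s, HasDerivAt h
      (Real.sigmoid (z + s) - Real.sigmoid z - sigmoidDeriv z * (s / 2)) s := by
    intro s
    have h1 : HasDerivAt (fun s => softplus (z + s)) (Real.sigmoid (z + s)) s :=
      HasDerivAt.comp_const_add z s (hasDerivAt_softplus (z + s))
    have h2 : HasDerivAt (fun s => Real.sigmoid z * s) (Real.sigmoid z) s := by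
      simpa using (hasDerivAt_id s).const_mul (Real.sigmoid z)
    have h3 : HasDerivAt (fun s => sigmoidDeriv z * s ^ 2 / 4) (sigmoidDeriv z * (s / 2)) s := by
      convert! ((hasDerivAt_pow 2 s).const_mul (sigmoidDeriv z)).div_const 4 using 1
      norm_num
      ring
    exact (h1.sub h2).sub h3
  have hcont : Continuous h := continuous_iff_continuousAt.2 fun s => (hd s).continuousAt
  have h0 : h 0 = softplus z := by simp [h]
  suffices h 0 ≤ h t by
    rw [h0] at this
    simp only [h] at this
    linarith
  obtain ⟨hl, hr⟩ := abs_le.1 ht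
  rcases le_total 0 t with h0t | h0t
  · refine monotoneOn_of_deriv_nonneg (convex_Icc 0 1) hcont.continuousOn
      (fun s _ => (hd s).differentiableAt.differentiableWithinAt) ?_
      ⟨le_rfl, zero_le_one⟩ ⟨h0t, hr⟩ h0t
    intro s hs
    rw [interior_Icc] at hs
    rw [(hd s).deriv]
    linarith [sigmoid_add_sub_ge z hs.1.le hs.2.le]
  · refine antitoneOn_of_deriv_nonpos (convex_Icc (-1) 0) hcont.continuousOn
      (fun s _ => (hd s).differentiableAt.differentiableWithinAt) ?_
      ⟨hl, h0t⟩ ⟨by norm_num, le_rfl⟩ h0t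
    intro s hs
    rw [interior_Icc] at hs
    rw [(hd s).deriv]
    have := sigmoid_sub_sub_ge z (t := -s) (by linarith [hs.2]) (by linarith [hs.1])
    rw [sub_neg_eq_add] at this
    linarith

lemma softplus_add_gt (z : ℝ) {t : ℝ} (ht : t ≠ 0) :
    softplus z + Real.sigmoid z * t < softplus (z + t) := by
  have hne : z ≠ z + t := by simpa using ht
  have hc := strictConvexOn_softplus
  rcases lt_or_gt_of_ne ht with h | h
  · have := hc.slope_lt_of_hasDerivAt (x := z + t) (y := z) trivial trivial (by linarith)
      (hasDerivAt_softplus z)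
    rw [slope_def_field, div_lt_iff₀ (by linarith)] at this
    linarith
  · have := hc.lt_slope_of_hasDerivAt (x := z) (y := z + t) trivial trivial (by linarith)
      (hasDerivAt_softplus z)
    rw [slope_def_field, lt_div_iff₀ (by linarith)] at this
    linarith

end ContextualBTL

/-! ### Deterministic analysis of the logistic loss on a subspace. -/

namespace ContextualBTL

section LogisticLoss

variable {E : Type*} [NormedAddCommGroup E] [InnerProductSpace ℝ E]

/-- The logistic loss of the first `L` observations with covariates `X l` and responses `y l`. -/
noncomputable def logisticLoss (X : ℕ → E) (y : ℕ → ℝ) (L : ℕ) (β : E) : ℝ :=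
  ∑ l ∈ Finset.range L, (softplus (inner ℝ β (X l)) - y l * inner ℝ β (X l))

/-- The derivative of minus the logistic loss at `β` in the direction `v`. -/
noncomputable def logisticScore (X : ℕ → E) (y : ℕ → ℝ) (L : ℕ) (β v : E) : ℝ :=
  ∑ l ∈ Finset.range L, (y l - Real.sigmoid (inner ℝ β (X l))) * inner ℝ v (X l)

/-- The Hessian of the logistic loss at `β`, as a bilinear form. -/
noncomputable def logisticHess (X : ℕ → E) (L : ℕ) (β v w : E) : ℝ :=
  ∑ l ∈ Finset.range L, sigmoidDeriv (inner ℝ β (X l)) * (inner ℝ v (X l) * inner ℝ w (X l))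

variable {X : ℕ → E} {y : ℕ → ℝ} {L : ℕ} {V : Submodule ℝ E} {β₀ : E} {K s κ : ℝ}

lemma continuous_logisticLoss : Continuous (logisticLoss X y L) := by
  unfold logisticLoss
  refine continuous_finsetSum _ fun l _ => ?_
  have h : Continuous fun β : E => (inner ℝ β (X l) : ℝ) := by fun_prop
  exact (continuous_softplus.comp h).sub (continuous_const.mul h)

lemma convexOn_logisticLoss : ConvexOn ℝ Set.univ (logisticLoss X y L) := by
  refine ⟨convex_univ, fun b _ c _ s t hs ht hst => ?_⟩
  unfold logisticLoss
  simp only [smul_eq_mul, Finset.mul_sum]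
  rw [← Finset.sum_add_distrib]
  refine Finset.sum_le_sum fun l _ => ?_
  have := strictConvexOn_softplus.convexOn.2 (x := inner ℝ b (X l)) trivial
    (y := inner ℝ c (X l)) trivial hs ht hst
  simp only [smul_eq_mul] at this
  rw [inner_add_left, real_inner_smul_left, real_inner_smul_left]
  linarith

/-- Two distinct points of `V` are told apart by some covariate, and the softplus term of that
covariate is strictly convex between them. -/
lemma strictConvexOn_logisticLoss
    (h : ∀ v ∈ V, v ≠ 0 → ∃ l < L, (inner ℝ v (X l) : ℝ) ≠ 0) :
    StrictConvexOn ℝ V (logisticLoss X y L) := by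
  refine ⟨V.convex, fun b hb c hc hbc s t hs ht hst => ?_⟩
  unfold logisticLoss
  simp only [smul_eq_mul, Finset.mul_sum]
  rw [← Finset.sum_add_distrib]
  obtain ⟨m, hm, hne⟩ := h (b - c) (V.sub_mem hb hc) (sub_ne_zero.2 hbc)
  refine Finset.sum_lt_sum (fun l _ => ?_) ⟨m, Finset.mem_range.2 hm, ?_⟩
  · have := strictConvexOn_softplus.convexOn.2 (x := inner ℝ b (X l)) trivial
      (y := inner ℝ c (X l)) trivial hs.le ht.le hst
    simp only [smul_eq_mul] at this
    rw [inner_add_left, real_inner_smul_left, real_inner_smul_left]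
    linarith
  · have := strictConvexOn_softplus.2 (x := inner ℝ b (X m)) trivial
      (y := inner ℝ c (X m)) trivial
      (fun heq => hne (by rw [inner_sub_left, heq, sub_self])) hs ht hst
    simp only [smul_eq_mul] at this
    rw [inner_add_left, real_inner_smul_left, real_inner_smul_left]
    linarith

lemma hasDerivAt_logisticLoss (β v : E) :
    HasDerivAt (fun t : ℝ => logisticLoss X y L (β + t • v)) (-logisticScore X y L β v) 0 := by
  unfold logisticLoss logisticScore
  rw [← Finset.sum_neg_distrib]
  refine HasDerivAt.fun_sum fun l _ => ?_
  have h1 : HasDerivAt (fun t : ℝ => (inner ℝ (β + t • v) (X l) : ℝ)) (inner ℝ v (X l)) 0 := by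
    simp only [inner_add_left, real_inner_smul_left]
    simpa using ((hasDerivAt_id (0 : ℝ)).mul_const (inner ℝ v (X l) : ℝ)).const_add
      (inner ℝ β (X l) : ℝ)
  have h2 : HasDerivAt softplus (Real.sigmoid (inner ℝ β (X l)))
      (inner ℝ (β + (0 : ℝ) • v) (X l)) := by
    simpa using hasDerivAt_softplus (inner ℝ β (X l))
  convert! (h2.comp (0 : ℝ) h1).sub (h1.const_mul (y l)) using 1
  ring

lemma logisticScore_eq_zero_of_isMinOn {b v : E} (hb : b ∈ V)
    (hmin : IsMinOn (logisticLoss X y L) V b) (hv : v ∈ V) : logisticScore X y L b v = 0 := by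
  have hloc : IsLocalMin (fun t : ℝ => logisticLoss X y L (b + t • v)) 0 := by
    refine Filter.Eventually.of_forall fun t => ?_
    simpa using hmin (V.add_mem hb (V.smul_mem t hv))
  simpa using hloc.hasDerivAt_eq_zero (hasDerivAt_logisticLoss b v)

lemma logisticLoss_add_ge (hX : ∀ l, ‖X l‖ ≤ K) {v : E} (hv : K * ‖v‖ ≤ 1) :
    logisticLoss X y L β₀ - logisticScore X y L β₀ v + logisticHess X L β₀ v v / 4 ≤
      logisticLoss X y L (β₀ + v) := by
  unfold logisticLoss logisticScore logisticHess
  rw [Finset.sum_div, ← Finset.sum_sub_distrib, ← Finset.sum_add_distrib]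
  refine Finset.sum_le_sum fun l _ => ?_
  have ht : |(inner ℝ v (X l) : ℝ)| ≤ 1 := by
    refine (abs_real_inner_le_norm v (X l)).trans (le_trans ?_ hv)
    rw [mul_comm]
    exact mul_le_mul_of_nonneg_right (hX l) (norm_nonneg v)
  have := softplus_add_ge (inner ℝ β₀ (X l)) ht
  rw [inner_add_left]
  linarith

/-- Localization of the sublevel set. Where `K ‖v‖ ≤ 1`, the quadratic gain `κ ‖v‖² / 4` must not
exceed the linear term `s ‖v‖`; convexity rules out points farther away. -/
lemma norm_le_of_logisticLoss_le (hK : 0 < K) (hκ : 0 < κ) (hX : ∀ l, ‖X l‖ ≤ K) (hs0 : 0 ≤ s)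
    (hscore : ∀ v ∈ V, |logisticScore X y L β₀ v| ≤ s * ‖v‖)
    (hHess : ∀ v ∈ V, κ * ‖v‖ ^ 2 ≤ logisticHess X L β₀ v v) (hs : 4 * s * K < κ)
    {v : E} (hv : v ∈ V) (hle : logisticLoss X y L (β₀ + v) ≤ logisticLoss X y L β₀) :
    ‖v‖ ≤ 4 * s / κ := by
  have key : ∀ u ∈ V, K * ‖u‖ ≤ 1 → logisticLoss X y L (β₀ + u) ≤ logisticLoss X y L β₀ →
      u ≠ 0 → κ * ‖u‖ ≤ 4 * s := by
    intro u hu hu1 hul hu0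
    have h1 := logisticLoss_add_ge (y := y) (L := L) (β₀ := β₀) hX hu1
    have h2 := (abs_le.1 (hscore u hu)).2
    have h3 := hHess u hu
    have hpos : 0 < ‖u‖ := norm_pos_iff.2 hu0
    nlinarith
  rcases eq_or_ne v 0 with rfl | hv0
  · rw [norm_zero]; positivity
  have hpos : 0 < ‖v‖ := norm_pos_iff.2 hv0
  rw [le_div_iff₀ hκ, mul_comm]
  rcases le_or_gt (K * ‖v‖) 1 with h1 | h1
  · exact key v hv h1 hle hv0
  · exfalso
    -- Pull the point back along the segment to radius `1 / K`, where the quadratic bound still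
    -- applies. Convexity keeps its loss at most that of `β₀`, so `κ / K ≤ 4 s`, contrary to `hs`.
    set r : ℝ := (K * ‖v‖)⁻¹
    have hr0 : 0 < r := by positivity
    have hr1 : r < 1 := inv_lt_one_of_one_lt₀ h1
    have hnorm : K * ‖r • v‖ = 1 := by
      rw [norm_smul, Real.norm_of_nonneg hr0.le]
      simp only [r]
      field_simp
    have hconv := (convexOn_logisticLoss (X := X) (y := y) (L := L)).2 (x := β₀) trivial
      (y := β₀ + v) trivial (sub_nonneg.2 hr1.le) hr0.le (by ring)
    rw [show (1 - r) • β₀ + r • (β₀ + v) = β₀ + r • v by module] at hconv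
    simp only [smul_eq_mul] at hconv
    have := key (r • v) (V.smul_mem r hv) hnorm.le (by nlinarith) (by simp [hv0, hr0.ne'])
    nlinarith

lemma existsUnique_isMinOn_logisticLoss [FiniteDimensional ℝ E] (hK : 0 < K) (hκ : 0 < κ)
    (hX : ∀ l, ‖X l‖ ≤ K) (hβ₀ : β₀ ∈ V) (hs0 : 0 ≤ s)
    (hscore : ∀ v ∈ V, |logisticScore X y L β₀ v| ≤ s * ‖v‖)
    (hHess : ∀ v ∈ V, κ * ‖v‖ ^ 2 ≤ logisticHess X L β₀ v v) (hs : 4 * s * K < κ) :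
    ∃! b, b ∈ V ∧ IsMinOn (logisticLoss X y L) V b := by
  have hcomp : IsCompact ((V : Set E) ∩ Metric.closedBall β₀ (4 * s / κ)) :=
    (isCompact_closedBall _ _).inter_left V.closed_of_finiteDimensional
  obtain ⟨b, ⟨hbV, hb⟩, hmin⟩ := hcomp.exists_isMinOn
    ⟨β₀, hβ₀, Metric.mem_closedBall_self (by positivity)⟩
    (continuous_logisticLoss (X := X) (y := y) (L := L)).continuousOn
  -- The minimizer over the ball is global on `V`: points whose loss does not exceed that at the
  -- center lie in the ball, and all others lose to the center.
  have hbmin : IsMinOn (logisticLoss X y L) V b := by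
    intro c hc
    rcases le_or_gt (logisticLoss X y L c) (logisticLoss X y L β₀) with h | h
    · refine hmin ⟨hc, ?_⟩
      rw [Metric.mem_closedBall, dist_eq_norm]
      exact norm_le_of_logisticLoss_le hK hκ hX hs0 hscore hHess hs (V.sub_mem hc hβ₀)
        (by rwa [add_sub_cancel])
    · have h0 : logisticLoss X y L b ≤ logisticLoss X y L β₀ :=
        hmin ⟨hβ₀, Metric.mem_closedBall_self (by positivity)⟩
      exact h0.trans h.le
  refine ⟨b, ⟨hbV, hbmin⟩, ?_⟩
  rintro c ⟨hcV, hcmin⟩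
  refine (strictConvexOn_logisticLoss fun v hv hv0 => ?_).eq_of_isMinOn hcmin hbmin hcV hbV
  have hpos : 0 < ‖v‖ := norm_pos_iff.2 hv0
  have : 0 < logisticHess X L β₀ v v := lt_of_lt_of_le (by positivity) (hHess v hv)
  obtain ⟨l, hl, hne⟩ := Finset.exists_ne_zero_of_sum_ne_zero this.ne'
  exact ⟨l, Finset.mem_range.1 hl, fun h => hne (by simp [h])⟩

/-- The score vanishes at the minimizer, so the left side is the first-order Taylor remainder of the
score; each summand costs at most `(K ‖b - β₀‖)² * (K ‖v‖)`. -/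
lemma abs_logisticScore_sub_logisticHess_le (hX : ∀ l, ‖X l‖ ≤ K) {b : E}
    (hb : b ∈ V) (hmin : IsMinOn (logisticLoss X y L) V b) {v : E} (hv : v ∈ V) :
    |logisticScore X y L β₀ v - logisticHess X L β₀ v (b - β₀)| ≤
      L * (K ^ 3 * ‖b - β₀‖ ^ 2 * ‖v‖) := by
  have hK : 0 ≤ K := (norm_nonneg _).trans (hX 0)
  have h0 := logisticScore_eq_zero_of_isMinOn hb hmin hv
  rw [← sub_zero (logisticScore X y L β₀ v), ← h0]
  unfold logisticScore logisticHess
  rw [← Finset.sum_sub_distrib, ← Finset.sum_sub_distrib]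
  refine (Finset.abs_sum_le_sum_abs _ _).trans ?_
  refine (Finset.sum_le_card_nsmul _ _ (K ^ 3 * ‖b - β₀‖ ^ 2 * ‖v‖) fun l _ => ?_).trans_eq
    (by simp)
  set t : ℝ := inner ℝ (b - β₀) (X l)
  have hbt : (inner ℝ b (X l) : ℝ) = inner ℝ β₀ (X l) + t := by
    rw [← inner_add_left, add_sub_cancel]
  have hinner : ∀ u : E, |(inner ℝ u (X l) : ℝ)| ≤ K * ‖u‖ := fun u =>
    (abs_real_inner_le_norm u (X l)).trans (by
      rw [mul_comm]; exact mul_le_mul_of_nonneg_right (hX l) (norm_nonneg u))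
  have ht : t ^ 2 ≤ (K * ‖b - β₀‖) ^ 2 := by
    rw [← sq_abs]
    exact pow_le_pow_left₀ (abs_nonneg _) (hinner _) 2
  have hrem := abs_sigmoid_add_sub_le (inner ℝ β₀ (X l)) t
  rw [hbt]
  have : (y l - Real.sigmoid (inner ℝ β₀ (X l))) * inner ℝ v (X l) -
      (y l - Real.sigmoid (inner ℝ β₀ (X l) + t)) * inner ℝ v (X l) -
      sigmoidDeriv (inner ℝ β₀ (X l)) * (inner ℝ v (X l) * t) =
      (Real.sigmoid (inner ℝ β₀ (X l) + t) - Real.sigmoid (inner ℝ β₀ (X l)) -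
        sigmoidDeriv (inner ℝ β₀ (X l)) * t) * inner ℝ v (X l) := by ring
  rw [this, abs_mul]
  calc _ ≤ (K * ‖b - β₀‖) ^ 2 * (K * ‖v‖) :=
        mul_le_mul (hrem.trans ht) (hinner v) (abs_nonneg _) (by positivity)
    _ = _ := by ring

end LogisticLoss

end ContextualBTL

/-! ### Pseudoinverses, the constraint projector and coercivity on `Θ`. -/

namespace ContextualBTL

section MoorePenrose

variable {n : Type*} [Fintype n]

/-- Adding `1 - Q` to `A` fills in the missing directions and gives an invertible `N` with `Q N = N
Q = A`. Then `S = N⁻¹ Q` satisfies `A S = S A = Q`, from which the Penrose equations follow. -/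
lemma exists_isMoorePenroseInverse_posSemidef [DecidableEq n] {A Q : Matrix n n ℝ} (hQ : Qᵀ = Q) (hQQ : Q * Q = Q)
    (hA : Aᵀ = A) (hAQ : A * Q = A) (hpos : ∀ v : n → ℝ, Q *ᵥ v = v → v ≠ 0 → 0 < v ⬝ᵥ (A *ᵥ v)) :
    ∃ S : Matrix n n ℝ, IsMoorePenroseInverse A S ∧ S.PosSemidef ∧ S * A = Q ∧ Q * S = S := by
  have hQA : Q * A = A := by
    have := congrArg Matrix.transpose hAQ
    rwa [Matrix.transpose_mul, hQ, hA] at this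
  set N : Matrix n n ℝ := A + (1 - Q)
  have hNQ : N * Q = A := by simp [N, add_mul, sub_mul, hAQ, hQQ]
  have hQN : Q * N = A := by simp [N, mul_add, mul_sub, hQA, hQQ]
  have hinj : Function.Injective N.mulVec := by
    refine (injective_iff_map_eq_zero (Matrix.mulVecLin N)).2 fun v hv => ?_
    rw [Matrix.mulVecLin_apply] at hv
    have hAv : A *ᵥ v = 0 := by
      rw [← hQN, ← Matrix.mulVec_mulVec, hv, Matrix.mulVec_zero]
    have hQv : Q *ᵥ v = v := by
      have : v - Q *ᵥ v = 0 := by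
        simpa [N, Matrix.add_mulVec, Matrix.sub_mulVec, hAv] using hv
      exact (sub_eq_zero.1 this).symm
    by_contra hne
    have := hpos v hQv hne
    rw [hAv, dotProduct_zero] at this
    exact lt_irrefl _ this
  have hunit : IsUnit N := Matrix.mulVec_injective_iff_isUnit.1 hinj
  have hdet : IsUnit N.det := (Matrix.isUnit_iff_isUnit_det N).1 hunit
  have hinvA : N⁻¹ * A = Q := by rw [← hNQ, ← mul_assoc, Matrix.nonsing_inv_mul _ hdet, one_mul]
  have hAinv : A * N⁻¹ = Q := by rw [← hQN, mul_assoc, Matrix.mul_nonsing_inv _ hdet, mul_one]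
  have hcomm : Q * N⁻¹ = N⁻¹ * Q := by
    nth_rewrite 1 [← hinvA]
    rw [mul_assoc, hAinv]
  set S : Matrix n n ℝ := N⁻¹ * Q
  have hSA : S * A = Q := by rw [mul_assoc, hQA, hinvA]
  have hAS : A * S = Q := by rw [← mul_assoc, hAinv, hQQ]
  have hQS : Q * S = S := by rw [← mul_assoc, hcomm, mul_assoc, hQQ]
  have hNT : Nᵀ = N := by simp [N, hA, hQ]
  have hST : Sᵀ = S := by
    rw [Matrix.transpose_mul, hQ, Matrix.transpose_nonsing_inv, hNT, hcomm]
  have hSAS : S * A * S = S := by rw [hSA, hQS]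
  refine ⟨S, ⟨by rw [hAS, hQA], hSAS, by rw [hAS, hQ], by rw [hSA, hQ]⟩, ?_, hSA, hQS⟩
  refine Matrix.PosSemidef.of_dotProduct_mulVec_nonneg ?_ fun v => ?_
  · rw [Matrix.IsHermitian, Matrix.conjTranspose_eq_transpose_of_trivial, hST]
  · rw [star_trivial]
    have h1 : v ⬝ᵥ (S *ᵥ v) = (S *ᵥ v) ⬝ᵥ (A *ᵥ (S *ᵥ v)) := by
      nth_rewrite 1 [← hSAS]
      rw [mul_assoc, ← Matrix.mulVec_mulVec, Matrix.dotProduct_mulVec, ← Matrix.mulVec_transpose,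
        hST, Matrix.mulVec_mulVec]
    rw [h1]
    rcases eq_or_ne (S *ᵥ v) 0 with h | h
    · simp [h]
    · exact (hpos _ (by rw [Matrix.mulVec_mulVec, hQS]) h).le

lemma abs_dotProduct_mulVec_le {A : Matrix n n ℝ} {δ : ℝ} (hA : ∀ i j, |A i j| ≤ δ)
    (v w : EuclideanSpace ℝ n) :
    |v.ofLp ⬝ᵥ (A *ᵥ w.ofLp)| ≤ δ * (Fintype.card n) ^ 2 * ‖v‖ * ‖w‖ := by
  simp only [dotProduct, Matrix.mulVec, Finset.mul_sum]
  refine (Finset.abs_sum_le_sum_abs _ _).trans ?_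
  have hle : ∀ i j, |v i * (A i j * w j)| ≤ δ * ‖v‖ * ‖w‖ := by
    intro i j
    have h1 : |v i| ≤ ‖v‖ := PiLp.norm_apply_le v i
    have h2 : |w j| ≤ ‖w‖ := PiLp.norm_apply_le w j
    have hδ : 0 ≤ δ := (abs_nonneg _).trans (hA i j)
    rw [abs_mul, abs_mul]
    calc _ ≤ ‖v‖ * (δ * ‖w‖) := by
          gcongr
          exact hA i j
      _ = _ := by ring
  calc _ ≤ ∑ _i : n, ∑ _j : n, δ * ‖v‖ * ‖w‖ := Finset.sum_le_sum fun i _ =>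
        (Finset.abs_sum_le_sum_abs _ _).trans (Finset.sum_le_sum fun j _ => hle i j)
    _ = _ := by simp; ring

end MoorePenrose

variable {M d : ℕ}

/-- `Theta` as a linear subspace. -/
def thetaSubmodule (M d : ℕ) : Submodule ℝ (Param M d) where
  carrier := Theta M d
  zero_mem' := by simp [Theta]
  add_mem' := by
    rintro b c ⟨hb, hb'⟩ ⟨hc, hc'⟩
    exact ⟨by simp [Finset.sum_add_distrib, hb, hc],
      fun k => by simp [Finset.sum_add_distrib, hb' k, hc' k]⟩
  smul_mem' := by
    rintro t b ⟨hb, hb'⟩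
    exact ⟨by simp [← Finset.mul_sum, hb], fun k => by simp [← Finset.mul_sum, hb' k]⟩

lemma constraintMatrix_mulVec_eq_zero_iff (v : Param M d) :
    constraintMatrix M d *ᵥ v.ofLp = 0 ↔ v ∈ Theta M d := by
  have h1 : ∀ u, (constraintMatrix M d *ᵥ v.ofLp) (Sum.inl u) = ∑ m, v (Sum.inl m) := by
    intro u
    simp [constraintMatrix, Matrix.mulVec, dotProduct]
  have h2 : ∀ k, (constraintMatrix M d *ᵥ v.ofLp) (Sum.inr k) = ∑ m, v (Sum.inr (m, k)) := by
    intro k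
    simp [constraintMatrix, Matrix.mulVec, dotProduct, Fintype.sum_prod_type]
  constructor
  · intro h
    exact ⟨by rw [← h1 (), h]; rfl, fun k => by rw [← h2 k, h]; rfl⟩
  · rintro ⟨h, h'⟩
    ext (u | k)
    · rw [h1, h]; rfl
    · rw [h2, h']; rfl

/-- The constraints involve disjoint sets of `M` coordinates, each with coefficient one, so the rows
are orthogonal with squared norm `M`. -/
lemma constraintMatrix_mul_transpose :
    constraintMatrix M d * (constraintMatrix M d)ᵀ = (M : ℝ) • 1 := by
  ext i j
  rcases i with u | k <;> rcases j with w | r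
  · simp [constraintMatrix, Matrix.mul_apply]
  · simp [constraintMatrix, Matrix.mul_apply]
  · simp [constraintMatrix, Matrix.mul_apply]
  · rcases eq_or_ne k r with rfl | h
    · simp [constraintMatrix, Matrix.mul_apply, Fintype.sum_prod_type]
    · simp [constraintMatrix, Matrix.mul_apply, Fintype.sum_prod_type, h, h.symm]

lemma constraintMatrix_mul_transpose_inv (hM : M ≠ 0) :
    (constraintMatrix M d * (constraintMatrix M d)ᵀ)⁻¹ = (M : ℝ)⁻¹ • 1 := by
  refine Matrix.inv_eq_left_inv ?_
  rw [constraintMatrix_mul_transpose]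
  have : (M : ℝ) ≠ 0 := by exact_mod_cast hM
  simp [smul_smul, this]

lemma projMatrix_eq (hM : M ≠ 0) : projMatrix M d =
    1 - (M : ℝ)⁻¹ • ((constraintMatrix M d)ᵀ * constraintMatrix M d) := by
  rw [projMatrix, constraintMatrix_mul_transpose_inv hM]
  simp

lemma projMatrix_transpose (hM : M ≠ 0) : (projMatrix M d)ᵀ = projMatrix M d := by
  rw [projMatrix_eq hM]
  simp [Matrix.transpose_sub, Matrix.transpose_mul]

lemma constraintMatrix_mul_projMatrix (hM : M ≠ 0) :
    constraintMatrix M d * projMatrix M d = 0 := by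
  have : (M : ℝ) ≠ 0 := by exact_mod_cast hM
  rw [projMatrix_eq hM, Matrix.mul_sub, Matrix.mul_smul, ← Matrix.mul_assoc, constraintMatrix_mul_transpose]
  simp [smul_smul, this]

lemma projMatrix_mul_self (hM : M ≠ 0) : projMatrix M d * projMatrix M d = projMatrix M d := by
  nth_rewrite 1 [projMatrix_eq hM]
  rw [sub_mul, smul_mul_assoc, Matrix.mul_assoc, constraintMatrix_mul_projMatrix hM]
  simp

lemma projMatrix_mulVec_eq_self_iff (hM : M ≠ 0) (v : Param M d) :
    projMatrix M d *ᵥ v.ofLp = v.ofLp ↔ v ∈ Theta M d := by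
  rw [← constraintMatrix_mulVec_eq_zero_iff]
  constructor
  · intro h
    rw [← h, Matrix.mulVec_mulVec, constraintMatrix_mul_projMatrix hM, Matrix.zero_mulVec]
  · intro h
    rw [projMatrix_eq hM, Matrix.sub_mulVec, Matrix.smul_mulVec, ← Matrix.mulVec_mulVec, h]
    simp

/-- On `Θ` the quadratic forms of `A` and of the projected `A` agree, so positivity on `Θ` suffices.
Since `S` absorbs the projector on both sides, the Penrose relations hold with `A` in place of its
projection, the form used for the linearization and the covariance. -/
lemma exists_posSemidef_pseudoinverse (hM : M ≠ 0) {A : Matrix (Idx M d) (Idx M d) ℝ}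
    (hA : Aᵀ = A) (hpos : PosDefOnTheta A) :
    ∃ S : Matrix (Idx M d) (Idx M d) ℝ,
      IsMoorePenroseInverse (projMatrix M d * A * projMatrix M d) S ∧ S.PosSemidef ∧
      S * A * S = S ∧
      (∀ v : Param M d, WithLp.toLp 2 (S *ᵥ v.ofLp) ∈ Theta M d) ∧
      ∀ v ∈ Theta M d, S *ᵥ (A *ᵥ v.ofLp) = v.ofLp := by
  set Q := projMatrix M d
  have hQ : Qᵀ = Q := projMatrix_transpose hM
  have hQQ : Q * Q = Q := projMatrix_mul_self hM
  obtain ⟨S, hS, hpsd, hSA, hQS⟩ := exists_isMoorePenroseInverse_posSemidef (A := Q * A * Q) hQ hQQ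
    (by simp [Matrix.transpose_mul, hQ, hA, mul_assoc]) (by simp only [mul_assoc, hQQ])
    (fun v hv hne => by
      have hmem : WithLp.toLp 2 v ∈ Theta M d :=
        (projMatrix_mulVec_eq_self_iff hM (WithLp.toLp 2 v)).1 hv
      have h := hpos (WithLp.toLp 2 v) hmem (by simpa using hne)
      have h2 : v ⬝ᵥ ((Q * A * Q) *ᵥ v) = v ⬝ᵥ (A *ᵥ v) := by
        rw [← Matrix.mulVec_mulVec, hv, ← Matrix.mulVec_mulVec, Matrix.dotProduct_mulVec,
          ← Matrix.mulVec_transpose, hQ, hv]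
      rw [h2]
      exact h)
  have hST : Sᵀ = S := by
    have := hpsd.1
    rwa [Matrix.IsHermitian, Matrix.conjTranspose_eq_transpose_of_trivial] at this
  have hSQ : S * Q = S := by
    have := congrArg Matrix.transpose hQS
    rwa [Matrix.transpose_mul, hQ, hST] at this
  have hmul : S * A * S = S := by
    nth_rewrite 3 [← hS.self_mul_mul]
    nth_rewrite 1 [← hSQ]
    nth_rewrite 2 [← hQS]
    simp only [mul_assoc]
  refine ⟨S, hS, hpsd, hmul, fun v => ?_, fun v hv => ?_⟩
  · rw [← projMatrix_mulVec_eq_self_iff hM]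
    simp [Matrix.mulVec_mulVec, Q, hQS]
  · have hv' : Q *ᵥ v.ofLp = v.ofLp := (projMatrix_mulVec_eq_self_iff hM v).2 hv
    calc S *ᵥ (A *ᵥ v.ofLp) = (S * (Q * A * Q)) *ᵥ v.ofLp := by
          simp only [← mul_assoc, hSQ]
          rw [← Matrix.mulVec_mulVec, hv', ← Matrix.mulVec_mulVec]
      _ = v.ofLp := by rw [hSA, hv']

/-- The constant is the minimum of the form over the compact unit sphere of `Θ`, and homogeneity
does the rest; an empty sphere means `Θ = 0`. -/
lemma PosDefOnTheta.exists_coercive {A : Matrix (Idx M d) (Idx M d) ℝ} (hpos : PosDefOnTheta A) :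
    ∃ c > 0, ∀ v ∈ Theta M d, c * ‖v‖ ^ 2 ≤ v.ofLp ⬝ᵥ (A *ᵥ v.ofLp) := by
  set q : Param M d → ℝ := fun v => v.ofLp ⬝ᵥ (A *ᵥ v.ofLp)
  have hq : Continuous q := by
    have h : Continuous fun v : Param M d => v.ofLp := PiLp.continuous_ofLp 2 _
    exact h.dotProduct (continuous_const.matrix_mulVec h)
  have hqs : ∀ (t : ℝ) v, q (t • v) = t ^ 2 * q v := by
    intro t v
    simp only [q, WithLp.ofLp_smul, Matrix.mulVec_smul, smul_dotProduct, dotProduct_smul,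
      smul_eq_mul]
    ring
  have hcomp : IsCompact ((thetaSubmodule M d : Set (Param M d)) ∩ Metric.sphere 0 1) :=
    (isCompact_sphere _ _).inter_left (thetaSubmodule M d).closed_of_finiteDimensional
  rcases ((thetaSubmodule M d : Set (Param M d)) ∩ Metric.sphere 0 1).eq_empty_or_nonempty
    with hemp | hne
  · refine ⟨1, one_pos, fun v hv => ?_⟩
    rcases eq_or_ne v 0 with rfl | hv0
    · simp
    · exfalso
      have : ‖v‖⁻¹ • v ∈ ((thetaSubmodule M d : Set (Param M d)) ∩ Metric.sphere 0 1) :=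
        ⟨(thetaSubmodule M d).smul_mem _ hv, by simp [norm_smul, hv0]⟩
      rw [hemp] at this
      exact this
  · obtain ⟨u, ⟨huT, hu1⟩, hmin⟩ := hcomp.exists_isMinOn hne hq.continuousOn
    have hu0 : u ≠ 0 := by
      rintro rfl
      simp at hu1
    refine ⟨q u, hpos u huT hu0, fun v hv => ?_⟩
    rcases eq_or_ne v 0 with rfl | hv0
    · simp
    · have hn : 0 < ‖v‖ := norm_pos_iff.2 hv0
      have : q u ≤ q (‖v‖⁻¹ • v) := hmin
        ⟨(thetaSubmodule M d).smul_mem _ hv, by simp [norm_smul, hv0]⟩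
      rw [hqs, inv_pow, ← div_eq_inv_mul, le_div_iff₀ (by positivity)] at this
      exact this

end ContextualBTL

/-! ### A central limit theorem and a Chebyshev bound for bounded independent variables. -/

namespace ContextualBTL

lemma norm_prod_sub_prod_le {ι : Type*} (s : Finset ι) (f g : ι → ℂ) (hf : ∀ i ∈ s, ‖f i‖ ≤ 1)
    (hg : ∀ i ∈ s, ‖g i‖ ≤ 1) : ‖∏ i ∈ s, f i - ∏ i ∈ s, g i‖ ≤ ∑ i ∈ s, ‖f i - g i‖ := by
  classical
  induction s using Finset.induction_on with
  | empty => simp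
  | insert a s ha ih =>
    rw [Finset.prod_insert ha, Finset.prod_insert ha, Finset.sum_insert ha]
    have h1 : ‖∏ i ∈ s, g i‖ ≤ 1 := by
      rw [norm_prod]
      exact Finset.prod_le_one (fun _ _ => norm_nonneg _)
        fun i hi => hg i (Finset.mem_insert_of_mem hi)
    have h2 := ih (fun i hi => hf i (Finset.mem_insert_of_mem hi))
      (fun i hi => hg i (Finset.mem_insert_of_mem hi))
    have h3 := hf a (Finset.mem_insert_self a s)
    calc _ = ‖f a * (∏ i ∈ s, f i - ∏ i ∈ s, g i) + (f a - g a) * ∏ i ∈ s, g i‖ := by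
          congr 1; ring
      _ ≤ ‖f a‖ * ‖∏ i ∈ s, f i - ∏ i ∈ s, g i‖ + ‖f a - g a‖ * ‖∏ i ∈ s, g i‖ := by
          refine (norm_add_le _ _).trans ?_
          rw [norm_mul, norm_mul]
      _ ≤ 1 * (∑ i ∈ s, ‖f i - g i‖) + ‖f a - g a‖ * 1 := by gcongr
      _ = _ := by ring

lemma norm_cexp_sub_taylor_le {x : ℝ} (hx : |x| ≤ 1) :
    ‖Complex.exp (x * Complex.I) - (1 + x * Complex.I - x ^ 2 / 2)‖ ≤ |x| ^ 3 := by
  have hnorm : ‖(x : ℂ) * Complex.I‖ = |x| := by simp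
  have h := Complex.exp_bound (x := x * Complex.I) (by rwa [hnorm]) (n := 3) (by norm_num)
  rw [hnorm] at h
  have hsum : ∑ m ∈ Finset.range 3, ((x : ℂ) * Complex.I) ^ m / m.factorial =
      1 + x * Complex.I - x ^ 2 / 2 := by
    simp [Finset.sum_range_succ, mul_pow, Nat.factorial]
    ring
  rw [hsum] at h
  refine h.trans ?_
  have : 0 ≤ |x| ^ 3 := by positivity
  norm_num [Nat.factorial]
  linarith

variable {Ω : Type*} [MeasurableSpace Ω] {P : Measure Ω} [IsProbabilityMeasure P]

/-- Both sides are compared with `1 - s² V / 2`, where `V` is the variance: the third-order Taylor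
error of the exponential gives the cubic term, and `|exp (-u) - 1 + u| ≤ u²` with `u = s² V / 2`
gives the quartic one. -/
lemma norm_charFun_map_sub_le {X : Ω → ℝ} (hX : AEMeasurable X P) {K : ℝ}
    (hK : ∀ᵐ ω ∂P, |X ω| ≤ K) (h0 : ∫ ω, X ω ∂P = 0) {s : ℝ} (hs : |s| * K ≤ 1) :
    ‖charFun (P.map X) s - Complex.exp (-(s ^ 2 * (∫ ω, X ω ^ 2 ∂P) / 2 : ℝ))‖ ≤
      |s| ^ 3 * K ^ 3 + s ^ 4 * K ^ 4 := by
  have hK0 : 0 ≤ K := by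
    obtain ⟨ω, hω⟩ := hK.exists
    exact (abs_nonneg _).trans hω
  have hint : Integrable X P :=
    Integrable.of_bound hX.aestronglyMeasurable K (by simpa using hK)
  have hint2 : Integrable (fun ω => X ω ^ 2) P := by
    refine Integrable.of_bound (hX.pow_const 2).aestronglyMeasurable (K ^ 2) ?_
    filter_upwards [hK] with ω hω
    rw [norm_pow]
    exact pow_le_pow_left₀ (abs_nonneg _) hω 2
  have hintC : Integrable (fun ω => (X ω : ℂ)) P := hint.ofReal
  have hint2C : Integrable (fun ω => ((X ω ^ 2 : ℝ) : ℂ)) P := hint2.ofReal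
  set V : ℝ := ∫ ω, X ω ^ 2 ∂P
  have hV0 : 0 ≤ V := integral_nonneg fun ω => sq_nonneg _
  have hVK : V ≤ K ^ 2 := by
    have : V ≤ ∫ _ω, K ^ 2 ∂P := by
      refine integral_mono_ae hint2 (integrable_const _) ?_
      filter_upwards [hK] with ω hω
      rw [← sq_abs]
      exact pow_le_pow_left₀ (abs_nonneg _) hω 2
    simpa using this
  have hpoly : ∫ ω, (1 + ((s * X ω : ℝ) : ℂ) * Complex.I - ((s * X ω : ℝ) : ℂ) ^ 2 / 2) ∂P =
      ((1 - s ^ 2 * V / 2 : ℝ) : ℂ) := by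
    have heq : ∀ ω, (1 + ((s * X ω : ℝ) : ℂ) * Complex.I - ((s * X ω : ℝ) : ℂ) ^ 2 / 2) =
        1 + (s * Complex.I) * (X ω : ℂ) - (s ^ 2 / 2 : ℂ) * ((X ω ^ 2 : ℝ) : ℂ) := by
      intro ω; push_cast; ring
    simp_rw [heq]
    have hlin : Integrable (fun ω => 1 + (s * Complex.I) * (X ω : ℂ)) P :=
      (integrable_const _).add (hintC.const_mul _)
    rw [integral_sub hlin (hint2C.const_mul _),
      integral_add (integrable_const _) (hintC.const_mul _), integral_const_mul,
      integral_const_mul, integral_complex_ofReal, integral_complex_ofReal, h0]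
    simp [V]
    ring
  have hchar : charFun (P.map X) s = ∫ ω, Complex.exp (((s * X ω : ℝ) : ℂ) * Complex.I) ∂P := by
    rw [charFun_apply_real, integral_map hX (by fun_prop)]
    push_cast
    rfl
  have hsmall : ∀ᵐ ω ∂P, |s * X ω| ≤ |s| * K := by
    filter_upwards [hK] with ω hω
    rw [abs_mul]
    gcongr
  have h1 : ‖charFun (P.map X) s - ((1 - s ^ 2 * V / 2 : ℝ) : ℂ)‖ ≤ |s| ^ 3 * K ^ 3 := by
    rw [hchar, ← hpoly, ← integral_sub]
    · refine (norm_integral_le_of_norm_le_const (C := |s| ^ 3 * K ^ 3) ?_).trans_eq (by simp)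
      filter_upwards [hsmall] with ω hω
      refine (norm_cexp_sub_taylor_le (hω.trans hs)).trans ?_
      rw [← mul_pow]
      exact pow_le_pow_left₀ (abs_nonneg _) hω 3
    · refine Integrable.of_bound (C := 1) ?_ (ae_of_all _ fun ω => ?_)
      · have : AEMeasurable (fun ω => Complex.exp (((s * X ω : ℝ) : ℂ) * Complex.I)) P := by
          fun_prop
        exact this.aestronglyMeasurable
      · rw [Complex.norm_exp_ofReal_mul_I]
    · refine Integrable.of_bound (C := 1 + 1 + 1 / 2) ?_ ?_
      · have : AEMeasurable (fun ω => 1 + ((s * X ω : ℝ) : ℂ) * Complex.I -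
            ((s * X ω : ℝ) : ℂ) ^ 2 / 2) P := by fun_prop
        exact this.aestronglyMeasurable
      · filter_upwards [hsmall] with ω hω
        have h := hω.trans hs
        refine (norm_sub_le _ _).trans (add_le_add ((norm_add_le _ _).trans
          (add_le_add (by simp) ?_)) ?_)
        · simpa using h
        · rw [norm_div, norm_pow, Complex.norm_real, Real.norm_eq_abs]
          have := pow_le_one₀ (n := 2) (abs_nonneg _) h
          simp only [Complex.norm_ofNat]
          linarith
  have h2 : ‖((1 - s ^ 2 * V / 2 : ℝ) : ℂ) - Complex.exp (-(s ^ 2 * V / 2 : ℝ))‖ ≤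
      s ^ 4 * K ^ 4 := by
    rw [← Complex.ofReal_neg, ← Complex.ofReal_exp, ← Complex.ofReal_sub, Complex.norm_real,
      Real.norm_eq_abs, abs_sub_comm]
    set u : ℝ := s ^ 2 * V / 2
    have hu0 : 0 ≤ u := by positivity
    have hu1 : u ≤ s ^ 2 * K ^ 2 := by
      have : s ^ 2 * V ≤ s ^ 2 * K ^ 2 := by gcongr
      have : 0 ≤ s ^ 2 * V := by positivity
      simp only [u]
      linarith
    have hle1 : s ^ 2 * K ^ 2 ≤ 1 := by
      rw [← sq_abs s, ← mul_pow]
      exact pow_le_one₀ (by positivity) hs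
    have := Real.abs_exp_sub_one_sub_id_le (x := -u) (by rw [abs_neg, abs_of_nonneg hu0]; linarith)
    calc _ = |Real.exp (-u) - 1 - -u| := by congr 1; ring
      _ ≤ (-u) ^ 2 := this
      _ = u ^ 2 := by ring
      _ ≤ (s ^ 2 * K ^ 2) ^ 2 := by gcongr
      _ = _ := by ring
  calc _ ≤ _ := norm_sub_le_norm_sub_add_norm_sub _ ((1 - s ^ 2 * V / 2 : ℝ) : ℂ) _
    _ ≤ _ := add_le_add h1 h2

/-- The characteristic-function form of the central limit theorem for independent, centered,
uniformly bounded random variables whose averaged variances converge. -/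
theorem tendsto_charFun_inv_sqrt_mul_sum_of_bounded {ξ : ℕ → Ω → ℝ}
    (hξ : ∀ l, AEMeasurable (ξ l) P) (hindep : iIndepFun ξ P) {K : ℝ}
    (hK : ∀ l, ∀ᵐ ω ∂P, |ξ l ω| ≤ K) (h0 : ∀ l, ∫ ω, ξ l ω ∂P = 0) {v : ℝ}
    (hv : Tendsto (fun L : ℕ => (L : ℝ)⁻¹ * ∑ l ∈ Finset.range L, ∫ ω, ξ l ω ^ 2 ∂P) atTop (𝓝 v)) :
    Tendsto (fun L : ℕ => charFun (P.map fun ω => (√(L : ℝ))⁻¹ * ∑ l ∈ Finset.range L, ξ l ω) 1)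
      atTop (𝓝 (Complex.exp (-(v / 2 : ℝ)))) := by
  have hlim : Tendsto (fun L : ℕ => Complex.exp
      (-((L : ℝ)⁻¹ * (∑ l ∈ Finset.range L, ∫ ω, ξ l ω ^ 2 ∂P) / 2 : ℝ))) atTop
      (𝓝 (Complex.exp (-(v / 2 : ℝ)))) := by
    have hc : Continuous fun r : ℝ => Complex.exp (-(r / 2 : ℝ)) := by fun_prop
    exact (hc.tendsto v).comp hv
  have hs0 : Tendsto (fun L : ℕ => (√(L : ℝ))⁻¹) atTop (𝓝 0) :=
    tendsto_inv_atTop_zero.comp (Real.tendsto_sqrt_atTop.comp tendsto_natCast_atTop_atTop)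
  -- It suffices to compare with the Gaussian whose variance is the finite-`L` average. Both sides
  -- then factor over the summands.
  refine hlim.congr_dist ?_
  have hbound : Tendsto (fun L : ℕ => (√(L : ℝ))⁻¹ * K ^ 3 + ((√(L : ℝ))⁻¹) ^ 2 * K ^ 4) atTop
      (𝓝 0) := by
    have := (hs0.mul_const (K ^ 3)).add ((hs0.pow 2).mul_const (K ^ 4))
    simpa using this
  refine squeeze_zero' (Eventually.of_forall fun _ => dist_nonneg) ?_ hbound
  have hsK : ∀ᶠ L : ℕ in atTop, (√(L : ℝ))⁻¹ * K < 1 := by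
    have := hs0.mul_const K
    rw [zero_mul] at this
    exact this.eventually_lt_const one_pos
  filter_upwards [hsK, eventually_gt_atTop 0] with L hL hL0
  set s : ℝ := (√(L : ℝ))⁻¹
  have hLpos : (0 : ℝ) < L := by exact_mod_cast hL0
  have hspos : 0 ≤ s := by positivity
  have hsq : s ^ 2 = (L : ℝ)⁻¹ := by rw [inv_pow, Real.sq_sqrt hLpos.le]
  rw [dist_comm, dist_eq_norm, charFun_map_mul_comp (Finset.aemeasurable_fun_sum _ fun _ _ => hξ _),
    (hindep.restrict _).charFun_map_fun_finsetSum_eq_prod (fun _ _ => hξ _), mul_one,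
    Finset.prod_apply]
  have hexp : Complex.exp (-((L : ℝ)⁻¹ * (∑ l ∈ Finset.range L, ∫ ω, ξ l ω ^ 2 ∂P) / 2 : ℝ)) =
      ∏ l ∈ Finset.range L, Complex.exp (-(s ^ 2 * (∫ ω, ξ l ω ^ 2 ∂P) / 2 : ℝ)) := by
    rw [← Complex.exp_sum, hsq]
    congr 1
    push_cast
    rw [Finset.sum_neg_distrib, ← Finset.sum_div, Finset.mul_sum]
  rw [hexp]
  refine (norm_prod_sub_prod_le _ _ _ ?_ ?_).trans ?_
  · intro l _
    have := Measure.isProbabilityMeasure_map (hξ l)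
    exact norm_charFun_le_one _
  · intro l _
    rw [← Complex.ofReal_neg, ← Complex.ofReal_exp, Complex.norm_real, Real.norm_eq_abs,
      Real.abs_exp, Real.exp_le_one_iff, neg_nonpos]
    have : 0 ≤ ∫ ω, ξ l ω ^ 2 ∂P := integral_nonneg fun ω => sq_nonneg _
    positivity
  · refine (Finset.sum_le_card_nsmul _ _ _ fun l _ => norm_charFun_map_sub_le (hξ l) (hK l) (h0 l)
      (by rw [abs_of_nonneg hspos]; exact hL.le)).trans_eq ?_
    rw [abs_of_nonneg hspos, Finset.card_range, nsmul_eq_mul]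
    -- The `L` errors of size `s³ K³ + s⁴ K⁴` add up to `s K³ + s² K⁴`, which tends to zero.
    have : (L : ℝ) * s ^ 2 = 1 := by rw [hsq, mul_inv_cancel₀ hLpos.ne']
    linear_combination (s * K ^ 3 + s ^ 2 * K ^ 4) * this

/-- Chebyshev's inequality for a sum of independent bounded random variables. -/
lemma measure_abs_sum_sub_integral_ge_le {ξ : ℕ → Ω → ℝ}
    (hξ : ∀ l, AEMeasurable (ξ l) P) (hindep : iIndepFun ξ P) {K : ℝ}
    (hK : ∀ l, ∀ᵐ ω ∂P, |ξ l ω| ≤ K) (L : ℕ) {c : ℝ} (hc : 0 < c) :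
    P {ω | c ≤ |∑ l ∈ Finset.range L, ξ l ω - ∑ l ∈ Finset.range L, ∫ ω, ξ l ω ∂P|} ≤
      ENNReal.ofReal (L * K ^ 2 / c ^ 2) := by
  have hmem : ∀ l, MemLp (ξ l) 2 P := fun l =>
    MemLp.of_bound (hξ l).aestronglyMeasurable K (by simpa using hK l)
  have hint : ∀ l, Integrable (ξ l) P := fun l => (hmem l).integrable (by norm_num)
  have hvar : Var[∑ l ∈ Finset.range L, ξ l; P] ≤ L * K ^ 2 := by
    rw [IndepFun.variance_sum (fun l _ => hmem l)
      (fun i _ j _ hij => hindep.indepFun hij)]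
    refine (Finset.sum_le_card_nsmul _ _ (K ^ 2) fun l _ => ?_).trans_eq (by simp)
    refine (variance_le_sq_of_bounded (a := -K) (b := K) ?_ (hξ l)).trans_eq (by ring)
    filter_upwards [hK l] with ω hω
    exact abs_le.1 hω
  have h := meas_ge_le_variance_div_sq (memLp_finsetSum' (Finset.range L) fun l _ => hmem l) hc
  rw [show P[∑ l ∈ Finset.range L, ξ l] = ∑ l ∈ Finset.range L, ∫ ω, ξ l ω ∂P by
    simp only [Finset.sum_apply]
    exact integral_finsetSum _ fun l _ => hint l] at h
  simp only [Finset.sum_apply] at h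
  refine h.trans (ENNReal.ofReal_le_ofReal ?_)
  gcongr

end ContextualBTL

/-! ### Reduction to logistic regression, and the estimator on the good event. -/

namespace ContextualBTL

variable {M d : ℕ}

lemma inner_design (β : Param M d) (x : Covariate d) (c : Fin M × Fin M) :
    inner ℝ β (design x c) = utility β c.2 x - utility β c.1 x := by
  simp only [PiLp.inner_apply, design, slopeDesign, utility, Fintype.sum_sum_type,
    Fintype.sum_prod_type, Sum.elim_inl, Sum.elim_inr, RCLike.inner_apply, conj_trivial, sub_mul,
    Finset.sum_sub_distrib, Pi.single_apply, ite_mul, one_mul, zero_mul, Finset.sum_ite_eq',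
    Finset.mem_univ, if_true]
  have h : ∀ m : Fin M, ∑ r, ∑ k, (if r = m then x k * β (Sum.inr (r, k)) else 0) =
      ∑ k, x k * β (Sum.inr (m, k)) := by
    intro m
    rw [Finset.sum_comm]
    simp
  rw [h, h]
  ring

lemma exp_div_exp_add_exp (s t : ℝ) :
    Real.exp s / (Real.exp s + Real.exp t) = Real.sigmoid (s - t) := by
  rw [Real.sigmoid_def, neg_sub, Real.exp_sub]
  have := Real.exp_pos s
  have := Real.exp_pos t
  field_simp

/-- Outcomes coded as `0` and `1`. -/
def response (y : ℕ → Bool) (l : ℕ) : ℝ := if y l then 1 else 0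

lemma negLogLik_eq_logisticLoss (x : ℕ → Covariate d) (a : ℕ → Fin M × Fin M) (y : ℕ → Bool)
    (L : ℕ) : negLogLik x a y L = logisticLoss (fun l => design (x l) (a l)) (response y) L := by
  funext β
  exact Finset.sum_congr rfl fun l _ => bernoulli_negLog_eq _ _

lemma isConstrainedMLE_iff {x : ℕ → Covariate d} {a : ℕ → Fin M × Fin M} {y : ℕ → Bool}
    {L : ℕ} {b : Param M d} : IsConstrainedMLE x a y L b ↔ b ∈ thetaSubmodule M d ∧
      IsMinOn (logisticLoss (fun l => design (x l) (a l)) (response y) L) (thetaSubmodule M d) b := by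
  rw [IsConstrainedMLE, negLogLik_eq_logisticLoss]
  rfl

section Deterministic

/-- The Hessian of the logistic loss in matrix form. -/
noncomputable def hessMatrix {n : Type*} [Fintype n] (X : ℕ → EuclideanSpace ℝ n) (L : ℕ)
    (β : EuclideanSpace ℝ n) : Matrix n n ℝ :=
  Matrix.of fun i j => ∑ l ∈ Finset.range L, sigmoidDeriv (inner ℝ β (X l)) * (X l i * X l j)

/-- Minus the gradient of the logistic loss. -/
noncomputable def scoreVec {n : Type*} [Fintype n] (X : ℕ → EuclideanSpace ℝ n) (y : ℕ → ℝ) (L : ℕ)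
    (β : EuclideanSpace ℝ n) : EuclideanSpace ℝ n :=
  ∑ l ∈ Finset.range L, (y l - Real.sigmoid (inner ℝ β (X l))) • X l

variable {n : Type*} [Fintype n] {X : ℕ → EuclideanSpace ℝ n} {y : ℕ → ℝ} {L : ℕ}
  {β : EuclideanSpace ℝ n}

lemma logisticScore_eq_inner (v : EuclideanSpace ℝ n) :
    logisticScore X y L β v = inner ℝ v (scoreVec X y L β) := by
  simp [logisticScore, scoreVec, inner_sum, real_inner_smul_right]

lemma logisticHess_eq_dotProduct (v w : EuclideanSpace ℝ n) :
    logisticHess X L β v w = v.ofLp ⬝ᵥ (hessMatrix X L β *ᵥ w.ofLp) := by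
  simp only [logisticHess, hessMatrix, dotProduct, Matrix.mulVec, Matrix.of_apply,
    PiLp.inner_apply, RCLike.inner_apply, conj_trivial, Finset.sum_mul, Finset.mul_sum]
  simp_rw [Finset.sum_comm (s := Finset.range L)]
  rw [Finset.sum_comm]
  refine Finset.sum_congr rfl fun i _ => Finset.sum_congr rfl fun j _ =>
    Finset.sum_congr rfl fun l _ => ?_
  ring

lemma real_inner_eq_dotProduct (v w : EuclideanSpace ℝ n) :
    (inner ℝ v w : ℝ) = v.ofLp ⬝ᵥ w.ofLp := by
  simp [PiLp.inner_apply, dotProduct, mul_comm]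

end Deterministic

section GoodEvent

variable {X : ℕ → Param M d} {y : ℕ → ℝ} {L : ℕ} {βstar : Param M d}
  {A : Matrix (Idx M d) (Idx M d) ℝ} {K R δ c : ℝ}

lemma logisticHess_ge_of_close (hL : 0 < L)
    (hcoer : ∀ v ∈ Theta M d, c * ‖v‖ ^ 2 ≤ v.ofLp ⬝ᵥ (A *ᵥ v.ofLp))
    (hH : ∀ i j, |((L : ℝ)⁻¹ • hessMatrix X L βstar - A) i j| ≤ δ)
    (hδ : δ * (Fintype.card (Idx M d)) ^ 2 ≤ c / 2) {v : Param M d} (hv : v ∈ Theta M d) :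
    c * L / 2 * ‖v‖ ^ 2 ≤ logisticHess X L βstar v v := by
  have hLpos : (0 : ℝ) < L := by exact_mod_cast hL
  have h1 := (abs_le.1 (abs_dotProduct_mulVec_le hH v v)).1
  rw [Matrix.sub_mulVec, dotProduct_sub, Matrix.smul_mulVec, dotProduct_smul, smul_eq_mul,
    ← logisticHess_eq_dotProduct] at h1
  have h2 := hcoer v hv
  have h3 : δ * (Fintype.card (Idx M d)) ^ 2 * ‖v‖ * ‖v‖ ≤ c / 2 * ‖v‖ ^ 2 := by
    rw [mul_assoc, ← sq]
    gcongr
  have h4 : c / 2 * ‖v‖ ^ 2 ≤ (L : ℝ)⁻¹ * logisticHess X L βstar v v := by linarith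
  rw [← div_eq_inv_mul, le_div_iff₀ hLpos] at h4
  linarith

lemma abs_logisticScore_le (hL : 0 < L) (hU : ‖(√(L : ℝ))⁻¹ • scoreVec X y L βstar‖ ≤ R)
    (v : Param M d) : |logisticScore X y L βstar v| ≤ √(L : ℝ) * R * ‖v‖ := by
  have hs : 0 < √(L : ℝ) := Real.sqrt_pos.2 (by exact_mod_cast hL)
  rw [norm_smul, Real.norm_of_nonneg (inv_nonneg.2 hs.le), ← div_eq_inv_mul, div_le_iff₀ hs] at hU
  rw [logisticScore_eq_inner]
  refine (abs_real_inner_le_norm _ _).trans ?_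
  nlinarith [norm_nonneg v]

lemma existsUnique_minimizer_of_close (hL : 0 < L) (hK : 0 < K) (hc : 0 < c)
    (hβ : βstar ∈ Theta M d) (hX : ∀ l, ‖X l‖ ≤ K)
    (hcoer : ∀ v ∈ Theta M d, c * ‖v‖ ^ 2 ≤ v.ofLp ⬝ᵥ (A *ᵥ v.ofLp))
    (hH : ∀ i j, |((L : ℝ)⁻¹ • hessMatrix X L βstar - A) i j| ≤ δ)
    (hδ : δ * (Fintype.card (Idx M d)) ^ 2 ≤ c / 2)
    (hU : ‖(√(L : ℝ))⁻¹ • scoreVec X y L βstar‖ ≤ R) (hR : 8 * R * K < c * √(L : ℝ)) :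
    ∃! b, b ∈ thetaSubmodule M d ∧ IsMinOn (logisticLoss X y L) (thetaSubmodule M d) b := by
  have hLpos : (0 : ℝ) < L := by exact_mod_cast hL
  have hs : 0 < √(L : ℝ) := Real.sqrt_pos.2 hLpos
  have hR0 : 0 ≤ R := (norm_nonneg _).trans hU
  -- The curvature is of order `L` and the score of order `√L`; with these values the requirement `4
  -- s K < κ` is exactly `hR` multiplied by `√L / 2`.
  refine existsUnique_isMinOn_logisticLoss (κ := c * L / 2) (s := √(L : ℝ) * R) hK (by positivity)
    hX hβ (by positivity) (fun v _ => abs_logisticScore_le hL hU v)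
    (fun v hv => logisticHess_ge_of_close hL hcoer hH hδ hv) ?_
  nlinarith [Real.mul_self_sqrt hLpos.le]

/-- The first-order condition says that `A w` and the normalized score nearly agree when tested
against `Θ`, where `w` is the rescaled error. Applying `S`, which maps into `Θ` and inverts `A`
there, recovers `w`. -/
lemma norm_sub_pseudoinverse_mulVec_score_le (hL : 0 < L) (hK : 0 < K) (hc : 0 < c)
    (hβ : βstar ∈ Theta M d) (hX : ∀ l, ‖X l‖ ≤ K)
    (hcoer : ∀ v ∈ Theta M d, c * ‖v‖ ^ 2 ≤ v.ofLp ⬝ᵥ (A *ᵥ v.ofLp))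
    (hδ0 : 0 ≤ δ) (hH : ∀ i j, |((L : ℝ)⁻¹ • hessMatrix X L βstar - A) i j| ≤ δ)
    (hδ : δ * (Fintype.card (Idx M d)) ^ 2 ≤ c / 2)
    (hU : ‖(√(L : ℝ))⁻¹ • scoreVec X y L βstar‖ ≤ R) (hR : 8 * R * K < c * √(L : ℝ))
    {S : Matrix (Idx M d) (Idx M d) ℝ} (hST : Sᵀ = S)
    (hSmem : ∀ v : Param M d, WithLp.toLp 2 (S *ᵥ v.ofLp) ∈ Theta M d)
    (hSA : ∀ v ∈ Theta M d, S *ᵥ (A *ᵥ v.ofLp) = v.ofLp)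
    {b : Param M d} (hb : b ∈ thetaSubmodule M d)
    (hmin : IsMinOn (logisticLoss X y L) (thetaSubmodule M d) b) :
    ‖√(L : ℝ) • (b - βstar) -
        Matrix.toEuclideanCLM (𝕜 := ℝ) S ((√(L : ℝ))⁻¹ • scoreVec X y L βstar)‖ ≤
      ‖Matrix.toEuclideanCLM (𝕜 := ℝ) S‖ * (K ^ 3 * (8 * R / c) ^ 2 * (√(L : ℝ))⁻¹ +
        δ * (Fintype.card (Idx M d)) ^ 2 * (8 * R / c)) := by
  set s : ℝ := √(L : ℝ) with hsdef
  have hLpos : (0 : ℝ) < L := by exact_mod_cast hL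
  have hs : 0 < s := Real.sqrt_pos.2 hLpos
  have hss : s * s = L := Real.mul_self_sqrt hLpos.le
  have hR0 : 0 ≤ R := (norm_nonneg _).trans hU
  have hbβ : b - βstar ∈ thetaSubmodule M d := (thetaSubmodule M d).sub_mem hb hβ
  set w : Param M d := s • (b - βstar)
  have hw : w ∈ Theta M d := (thetaSubmodule M d).smul_mem s hbβ
  have hbnorm : ‖b - βstar‖ ≤ 4 * (s * R) / (c * L / 2) := by
    refine norm_le_of_logisticLoss_le (X := X) (y := y) (L := L) (V := thetaSubmodule M d)
      (β₀ := βstar) hK (by positivity) hX (by positivity)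
      (fun v _ => abs_logisticScore_le hL hU v)
      (fun v hv => logisticHess_ge_of_close hL hcoer hH hδ hv) ?_ hbβ ?_
    · nlinarith
    · rw [add_sub_cancel]
      exact hmin hβ
  have hwnorm : ‖w‖ ≤ 8 * R / c := by
    rw [norm_smul, Real.norm_of_nonneg hs.le]
    calc s * ‖b - βstar‖ ≤ s * (4 * (s * R) / (c * L / 2)) := by gcongr
      _ = 8 * R / c := by
        rw [← hss]
        field_simp
        ring
  set U : Param M d := s⁻¹ • scoreVec X y L βstar
  -- The first error is the Taylor remainder, smaller by `1/√L` after rescaling; the second replaces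
  -- the observed information by `A`.
  have hlin : ∀ v ∈ Theta M d, |v.ofLp ⬝ᵥ (A *ᵥ w.ofLp) - inner ℝ v U| ≤
      (K ^ 3 * (8 * R / c) ^ 2 * s⁻¹ + δ * (Fintype.card (Idx M d)) ^ 2 * (8 * R / c)) * ‖v‖ := by
    intro v hv
    have h1 := abs_logisticScore_sub_logisticHess_le (y := y) hX hb hmin
      (β₀ := βstar) (V := thetaSubmodule M d) hv
    have h2 := abs_dotProduct_mulVec_le hH v w
    rw [Matrix.sub_mulVec, dotProduct_sub, Matrix.smul_mulVec, dotProduct_smul, smul_eq_mul,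
      ← logisticHess_eq_dotProduct] at h2
    have h3 : s * (s⁻¹ * ((L : ℝ) * (K ^ 3 * ‖b - βstar‖ ^ 2 * ‖v‖))) =
        K ^ 3 * ‖w‖ ^ 2 * ‖v‖ := by
      rw [norm_smul, Real.norm_of_nonneg hs.le, ← hss]
      field_simp
    have hHw : (L : ℝ)⁻¹ * logisticHess X L βstar v w = s⁻¹ * logisticHess X L βstar v (b - βstar) := by
      rw [logisticHess_eq_dotProduct, logisticHess_eq_dotProduct]
      simp only [w, WithLp.ofLp_smul, Matrix.mulVec_smul, dotProduct_smul, smul_eq_mul]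
      rw [← hss]
      field_simp
    have hinner : (inner ℝ v U : ℝ) = s⁻¹ * logisticScore X y L βstar v := by
      rw [logisticScore_eq_inner, real_inner_smul_right]
    have h4 : |inner ℝ v U - (L : ℝ)⁻¹ * logisticHess X L βstar v w| ≤
        K ^ 3 * ‖w‖ ^ 2 * ‖v‖ * s⁻¹ := by
      rw [hHw, hinner, ← mul_sub, abs_mul, abs_of_pos (inv_pos.2 hs)]
      calc _ ≤ s⁻¹ * ((L : ℝ) * (K ^ 3 * ‖b - βstar‖ ^ 2 * ‖v‖)) := by gcongr
        _ = _ := by rw [← h3]; field_simp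
    have h5 : K ^ 3 * ‖w‖ ^ 2 * ‖v‖ * s⁻¹ ≤ K ^ 3 * (8 * R / c) ^ 2 * ‖v‖ * s⁻¹ := by gcongr
    have h6 : δ * (Fintype.card (Idx M d)) ^ 2 * ‖v‖ * ‖w‖ ≤
        δ * (Fintype.card (Idx M d)) ^ 2 * ‖v‖ * (8 * R / c) := by gcongr
    have h7 := abs_le.1 h2
    have h8 := abs_le.1 h4
    refine abs_le.2 ⟨?_, ?_⟩ <;> nlinarith
  set T := Matrix.toEuclideanCLM (𝕜 := ℝ) S
  have hT : ∀ u : Param M d, T u = WithLp.toLp 2 (S *ᵥ u.ofLp) := fun u => rfl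
  have hTsymm : ∀ u v : Param M d, (inner ℝ u (T v) : ℝ) = inner ℝ (T u) v := by
    intro u v
    rw [real_inner_eq_dotProduct, real_inner_eq_dotProduct, hT, hT]
    rw [Matrix.dotProduct_mulVec, ← Matrix.mulVec_transpose, hST]
  set e : Param M d := w - T U
  have hwT : w = T (WithLp.toLp 2 (A *ᵥ w.ofLp)) := by
    rw [hT]
    simp [hSA w hw]
  -- Symmetry of `T` and `w = T (A w)` turn `‖e‖²` into the defect of the approximate equation
  -- tested at `T e`, an element of `Θ`. Dividing by `‖e‖` finishes the estimate.
  have hee : ‖e‖ ^ 2 = (T e).ofLp ⬝ᵥ (A *ᵥ w.ofLp) - inner ℝ (T e) U := by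
    have h1 : (inner ℝ e w : ℝ) = (T e).ofLp ⬝ᵥ (A *ᵥ w.ofLp) := by
      nth_rewrite 1 [hwT]
      rw [hTsymm, real_inner_eq_dotProduct]
    rw [← h1, ← hTsymm, ← inner_sub_right, real_inner_self_eq_norm_sq]
  have hle := (le_abs_self _).trans (hlin (T e) (by rw [hT]; exact hSmem e))
  rw [← hee] at hle
  have hTe : ‖T e‖ ≤ ‖T‖ * ‖e‖ := T.le_opNorm e
  set G : ℝ := K ^ 3 * (8 * R / c) ^ 2 * s⁻¹ + δ * (Fintype.card (Idx M d)) ^ 2 * (8 * R / c)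
  have hG : 0 ≤ G := by positivity
  rcases eq_or_ne ‖e‖ 0 with h0 | h0
  · rw [h0]
    positivity
  · have hpos : 0 < ‖e‖ := lt_of_le_of_ne (norm_nonneg e) (Ne.symm h0)
    have : G * ‖T e‖ ≤ G * (‖T‖ * ‖e‖) := by gcongr
    nlinarith

end GoodEvent

end ContextualBTL

/-! ### Expectations under the sampling model and the population minimizer. -/

namespace ContextualBTL

variable {M d : ℕ} {Ω : Type*} [MeasurableSpace Ω] {P : Measure Ω} [IsProbabilityMeasure P]
  {x : ℕ → Covariate d} {p : Fin M × Fin M → ℝ} {βstar : Param M d}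
  {a : ℕ → Ω → Fin M × Fin M} {y : ℕ → Ω → Bool}

namespace IsBTLSample

omit [IsProbabilityMeasure P] in
lemma pair_prob_nonneg (h : IsBTLSample P x p βstar a y) (c : Fin M × Fin M) : 0 ≤ p c := by
  rw [← h.pair_prob 0 c.1 c.2]
  exact measureReal_nonneg

/-- Pairs of probability zero almost surely never occur, so bounds assumed only for pairs with `0 <
p c` hold along the sample. -/
lemma ae_pair_prob_pos (h : IsBTLSample P x p βstar a y) : ∀ᵐ ω ∂P, ∀ l, 0 < p (a l ω) := by
  rw [ae_all_iff]
  intro l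
  have hc : ∀ c : Fin M × Fin M, ∀ᵐ ω ∂P, a l ω = c → 0 < p c := by
    intro c
    rcases (h.pair_prob_nonneg c).lt_or_eq with hpos | h0
    · exact ae_of_all _ fun _ _ => hpos
    · have hz : P.real {ω | a l ω = c} = 0 := by rw [h.pair_prob l c.1 c.2, ← h0]
      rw [measureReal_eq_zero_iff] at hz
      rw [ae_iff]
      refine measure_mono_null (fun ω hω => ?_) hz
      by_contra hne
      exact hω fun heq => absurd heq hne
  filter_upwards [ae_all_iff.2 hc] with ω hω
  exact hω _ rfl

lemma measureReal_eq (h : IsBTLSample P x p βstar a y) (l : ℕ) (c : Fin M × Fin M) :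
    P.real {ω | a l ω = c ∧ y l ω = true} =
        p c * Real.sigmoid (inner ℝ βstar (design (x l) c)) ∧
      P.real {ω | a l ω = c ∧ y l ω = false} =
        p c * (1 - Real.sigmoid (inner ℝ βstar (design (x l) c))) := by
  have h1 : P.real {ω | a l ω = c ∧ y l ω = true} =
      p c * Real.sigmoid (inner ℝ βstar (design (x l) c)) := by
    rw [inner_design, ← exp_div_exp_add_exp]
    exact h.outcome_prob l c.1 c.2
  refine ⟨h1, ?_⟩
  have hm : MeasurableSet {ω | a l ω = c ∧ y l ω = false} :=
    (h.measurable_pair l (measurableSet_singleton c)).inter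
      (h.measurable_outcome l (measurableSet_singleton false))
  have hunion : {ω | a l ω = c} =
      {ω | a l ω = c ∧ y l ω = true} ∪ {ω | a l ω = c ∧ y l ω = false} := by
    ext ω
    cases hy : y l ω <;> simp [hy]
  have hdisj : Disjoint {ω | a l ω = c ∧ y l ω = true} {ω | a l ω = c ∧ y l ω = false} := by
    rw [Set.disjoint_left]
    rintro ω ⟨_, h1⟩ ⟨_, h2⟩
    rw [h1] at h2
    exact Bool.noConfusion h2
  have hsum := measureReal_union (μ := P) hdisj hm
  rw [← hunion, h1, h.pair_prob l c.1 c.2] at hsum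
  linarith

lemma integral_eq (h : IsBTLSample P x p βstar a y) (l : ℕ) (F : Fin M × Fin M → Bool → ℝ) :
    ∫ ω, F (a l ω) (y l ω) ∂P =
      ∑ c, p c * (Real.sigmoid (inner ℝ βstar (design (x l) c)) * F c true +
        (1 - Real.sigmoid (inner ℝ βstar (design (x l) c))) * F c false) := by
  have hmeas : Measurable fun ω => (a l ω, y l ω) :=
    (h.measurable_pair l).prodMk (h.measurable_outcome l)
  have := Measure.isProbabilityMeasure_map (μ := P) hmeas.aemeasurable
  have h1 : ∫ ω, F (a l ω) (y l ω) ∂P =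
      ∫ t, F t.1 t.2 ∂(P.map fun ω => (a l ω, y l ω)) := by
    rw [integral_map hmeas.aemeasurable (by fun_prop)]
  rw [h1, integral_fintype (Integrable.of_finite), Fintype.sum_prod_type]
  refine Finset.sum_congr rfl fun c _ => ?_
  have hpre : ∀ b, (P.map fun ω => (a l ω, y l ω)).real {(c, b)} =
      P.real {ω | a l ω = c ∧ y l ω = b} := by
    intro b
    rw [map_measureReal_apply hmeas (measurableSet_singleton _)]
    congr 1
    ext ω
    simp
  rw [Fintype.sum_bool, hpre, hpre, (h.measureReal_eq l c).1, (h.measureReal_eq l c).2]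
  simp only [smul_eq_mul]
  ring

omit [IsProbabilityMeasure P] in
lemma aemeasurable_comp (h : IsBTLSample P x p βstar a y) (l : ℕ)
    (F : Fin M × Fin M → Bool → ℝ) : AEMeasurable (fun ω => F (a l ω) (y l ω)) P :=
  ((measurable_of_finite fun t : (Fin M × Fin M) × Bool => F t.1 t.2).comp
    ((h.measurable_pair l).prodMk (h.measurable_outcome l))).aemeasurable

lemma integrable_comp (h : IsBTLSample P x p βstar a y) (l : ℕ)
    (F : Fin M × Fin M → Bool → ℝ) : Integrable (fun ω => F (a l ω) (y l ω)) P := by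
  refine Integrable.of_bound (h.aemeasurable_comp l F).aestronglyMeasurable
    (∑ c, ∑ b, |F c b|) (ae_of_all _ fun ω => ?_)
  rw [Real.norm_eq_abs]
  calc |F (a l ω) (y l ω)| ≤ ∑ b, |F (a l ω) b| :=
        Finset.single_le_sum (f := fun b => |F (a l ω) b|) (fun _ _ => abs_nonneg _)
          (Finset.mem_univ _)
    _ ≤ _ := Finset.single_le_sum (f := fun c => ∑ b, |F c b|)
        (fun _ _ => Finset.sum_nonneg fun _ _ => abs_nonneg _) (Finset.mem_univ _)

omit [IsProbabilityMeasure P] in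
lemma iIndepFun_comp (h : IsBTLSample P x p βstar a y) (F : ℕ → Fin M × Fin M → Bool → ℝ) :
    iIndepFun (fun l ω => F l (a l ω) (y l ω)) P :=
  h.indep.comp (fun l (t : (Fin M × Fin M) × Bool) => F l t.1 t.2) fun _ => measurable_of_finite _

end IsBTLSample

lemma fisherInfo_apply (L : ℕ) (β : Param M d) (i j : Idx M d) :
    fisherInfo x p L β i j = ∑ l ∈ Finset.range L, ∑ c, p c *
      (sigmoidDeriv (inner ℝ β (design (x l) c)) * (design (x l) c i * design (x l) c j)) := by
  simp only [fisherInfo, Matrix.sum_apply, Matrix.smul_apply, Matrix.vecMulVec_apply, smul_eq_mul,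
    sigmoidDeriv]
  refine Finset.sum_congr rfl fun l _ => Finset.sum_congr rfl fun c _ => ?_
  ring

lemma dotProduct_fisherInfo_mulVec (L : ℕ) (β v : Param M d) :
    v.ofLp ⬝ᵥ (fisherInfo x p L β *ᵥ v.ofLp) = ∑ l ∈ Finset.range L, ∑ c, p c *
      (sigmoidDeriv (inner ℝ β (design (x l) c)) * (inner ℝ v (design (x l) c)) ^ 2) := by
  simp only [fisherInfo, Matrix.sum_mulVec, dotProduct_sum, Matrix.smul_mulVec, dotProduct_smul,
    Matrix.vecMulVec_mulVec, smul_eq_mul, sigmoidDeriv, real_inner_eq_dotProduct]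
  refine Finset.sum_congr rfl fun l _ => Finset.sum_congr rfl fun c _ => ?_
  rw [dotProduct_comm (design (x l) c).ofLp v.ofLp]
  simp
  ring

lemma fisherInfo_transpose (L : ℕ) (β : Param M d) :
    (fisherInfo x p L β)ᵀ = fisherInfo x p L β := by
  ext i j
  rw [Matrix.transpose_apply, fisherInfo_apply, fisherInfo_apply]
  simp only [mul_comm]

section Limit

variable {Ibar : Matrix (Idx M d) (Idx M d) ℝ}

lemma transpose_eq_of_tendsto_fisherInfo
    (hfisher : Tendsto (fun L : ℕ => (L : ℝ)⁻¹ • fisherInfo x p L βstar) atTop (𝓝 Ibar)) :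
    Ibarᵀ = Ibar := by
  refine tendsto_nhds_unique (f := fun L : ℕ => (L : ℝ)⁻¹ • fisherInfo x p L βstar) ?_ hfisher
  have hc : Continuous fun B : Matrix (Idx M d) (Idx M d) ℝ => Bᵀ := continuous_id.matrix_transpose
  refine ((hc.tendsto _).comp hfisher).congr fun L => ?_
  simp [Function.comp, fisherInfo_transpose]

lemma eventually_abs_fisherInfo_sub_le
    (hfisher : Tendsto (fun L : ℕ => (L : ℝ)⁻¹ • fisherInfo x p L βstar) atTop (𝓝 Ibar))
    {δ : ℝ} (hδ : 0 < δ) :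
    ∀ᶠ L : ℕ in atTop, ∀ i j, |((L : ℝ)⁻¹ • fisherInfo x p L βstar - Ibar) i j| ≤ δ := by
  refine eventually_all.2 fun i => eventually_all.2 fun j => ?_
  have h := tendsto_pi_nhds.1 (tendsto_pi_nhds.1 hfisher i) j
  filter_upwards [Metric.tendsto_nhds.1 h δ hδ] with L hL
  rw [Real.dist_eq] at hL
  exact hL.le

/-- The expected loss is eventually minimized over `Θ` at the true parameter only. -/
theorem eventually_integral_negLogLik_lt (h : IsBTLSample P x p βstar a y)
    (hβ : βstar ∈ Theta M d)
    (hfisher : Tendsto (fun L : ℕ => (L : ℝ)⁻¹ • fisherInfo x p L βstar) atTop (𝓝 Ibar))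
    (hpos : PosDefOnTheta Ibar) :
    ∀ᶠ L : ℕ in atTop, ∀ b ∈ Theta M d, b ≠ βstar →
      ∫ ω, negLogLik x (fun l => a l ω) (fun l => y l ω) L βstar ∂P <
        ∫ ω, negLogLik x (fun l => a l ω) (fun l => y l ω) L b ∂P := by
  obtain ⟨c, hc, hcoer⟩ := hpos.exists_coercive
  set N : ℝ := (Fintype.card (Idx M d) : ℝ) ^ 2
  have hN : 0 ≤ N := by positivity
  -- An entrywise error of this size changes the quadratic form by less than `c ‖v‖²` for `v ≠ 0`;
  -- the `+ 1` covers an empty index type.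
  have hδ : 0 < c / (2 * (N + 1)) := by positivity
  have hint : ∀ (L : ℕ) (b : Param M d),
      ∫ ω, negLogLik x (fun l => a l ω) (fun l => y l ω) L b ∂P =
        ∑ l ∈ Finset.range L, ∑ c, p c * (softplus (inner ℝ b (design (x l) c)) -
          Real.sigmoid (inner ℝ βstar (design (x l) c)) * inner ℝ b (design (x l) c)) := by
    intro L b
    simp_rw [negLogLik_eq_logisticLoss, logisticLoss, response]
    rw [integral_finsetSum]
    · refine Finset.sum_congr rfl fun l _ => ?_
      rw [h.integral_eq l fun c z => softplus (inner ℝ b (design (x l) c)) -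
        (if z then (1 : ℝ) else 0) * inner ℝ b (design (x l) c)]
      refine Finset.sum_congr rfl fun c _ => ?_
      simp only [if_true, Bool.false_eq_true, if_false]
      ring
    · exact fun l _ => h.integrable_comp l fun c z => softplus (inner ℝ b (design (x l) c)) -
        (if z then (1 : ℝ) else 0) * inner ℝ b (design (x l) c)
  filter_upwards [eventually_abs_fisherInfo_sub_le hfisher hδ, eventually_gt_atTop 0]
    with L hL hL0 b hb hne
  have hv : b - βstar ∈ Theta M d := (thetaSubmodule M d).sub_mem hb hβ
  have hvpos : 0 < ‖b - βstar‖ := norm_pos_iff.2 (sub_ne_zero.2 hne)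
  have hfpos : 0 < ∑ l ∈ Finset.range L, ∑ c, p c * (sigmoidDeriv (inner ℝ βstar (design (x l) c)) *
      (inner ℝ (b - βstar) (design (x l) c)) ^ 2) := by
    rw [← dotProduct_fisherInfo_mulVec]
    have h1 := (abs_le.1 (abs_dotProduct_mulVec_le hL (b - βstar) (b - βstar))).1
    rw [Matrix.sub_mulVec, dotProduct_sub, Matrix.smul_mulVec, dotProduct_smul, smul_eq_mul] at h1
    have h2 := hcoer _ hv
    have h3 : c / (2 * (N + 1)) * N * ‖b - βstar‖ * ‖b - βstar‖ < c * ‖b - βstar‖ ^ 2 := by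
      rw [mul_assoc, ← sq]
      refine mul_lt_mul_of_pos_right ?_ (by positivity)
      rw [div_mul_eq_mul_div, div_lt_iff₀ (by positivity)]
      nlinarith
    have h4 : 0 < (L : ℝ)⁻¹ * ((b - βstar).ofLp ⬝ᵥ (fisherInfo x p L βstar *ᵥ (b - βstar).ofLp)) := by
      linarith
    exact pos_of_mul_pos_right h4 (by positivity)
  have hp := h.pair_prob_nonneg
  -- Each term lies above its tangent line at the truth, strictly so wherever the corresponding
  -- information term is nonzero; `hfpos` supplies such a term.
  have hterm : ∀ l c, p c * (softplus (inner ℝ βstar (design (x l) c)) -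
      Real.sigmoid (inner ℝ βstar (design (x l) c)) * inner ℝ βstar (design (x l) c)) ≤
      p c * (softplus (inner ℝ b (design (x l) c)) -
      Real.sigmoid (inner ℝ βstar (design (x l) c)) * inner ℝ b (design (x l) c)) ∧
      (p c * (sigmoidDeriv (inner ℝ βstar (design (x l) c)) *
        (inner ℝ (b - βstar) (design (x l) c)) ^ 2) ≠ 0 →
      p c * (softplus (inner ℝ βstar (design (x l) c)) -
      Real.sigmoid (inner ℝ βstar (design (x l) c)) * inner ℝ βstar (design (x l) c)) <
      p c * (softplus (inner ℝ b (design (x l) c)) -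
      Real.sigmoid (inner ℝ βstar (design (x l) c)) * inner ℝ b (design (x l) c))) := by
    intro l c
    have hbz : (inner ℝ b (design (x l) c) : ℝ) = inner ℝ βstar (design (x l) c) +
        inner ℝ (b - βstar) (design (x l) c) := by
      rw [← inner_add_left, add_sub_cancel]
    rw [hbz]
    set t : ℝ := inner ℝ (b - βstar) (design (x l) c)
    set z : ℝ := inner ℝ βstar (design (x l) c)
    rcases eq_or_ne t 0 with ht | ht
    · rw [ht]
      simp
    · have hlt := softplus_add_gt z ht
      refine ⟨mul_le_mul_of_nonneg_left (by linarith) (hp c), fun hne => ?_⟩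
      have hpc : 0 < p c := lt_of_le_of_ne (hp c) (Ne.symm (left_ne_zero_of_mul hne))
      exact mul_lt_mul_of_pos_left (by linarith) hpc
  rw [hint, hint]
  obtain ⟨l, hl, hlne⟩ := Finset.exists_ne_zero_of_sum_ne_zero hfpos.ne'
  obtain ⟨c', _, hcne⟩ := Finset.exists_ne_zero_of_sum_ne_zero hlne
  exact Finset.sum_lt_sum (fun l _ => Finset.sum_le_sum fun c _ => (hterm l c).1)
    ⟨l, hl, Finset.sum_lt_sum (fun c _ => (hterm l c).1)
      ⟨c', Finset.mem_univ _, (hterm l c').2 hcne⟩⟩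

end Limit

end ContextualBTL

/-! ### Concentration of the score and the observed information, and the limit law of the score. -/

namespace ContextualBTL

variable {M d : ℕ} {Ω : Type*} [MeasurableSpace Ω] {P : Measure Ω} [IsProbabilityMeasure P]
  {x : ℕ → Covariate d} {p : Fin M × Fin M → ℝ} {βstar : Param M d}
  {a : ℕ → Ω → Fin M × Fin M} {y : ℕ → Ω → Bool} {K : ℝ}

lemma abs_response_sub_sigmoid_le (z : ℕ → Bool) (l : ℕ) (t : ℝ) :
    |response z l - Real.sigmoid t| ≤ 1 := by
  have h0 := Real.sigmoid_pos t
  have h1 := Real.sigmoid_lt_one t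
  unfold response
  split_ifs <;> exact abs_le.2 ⟨by linarith, by linarith⟩

/-- The normalized score at the true parameter. -/
noncomputable def normalizedScore (x : ℕ → Covariate d) (βstar : Param M d)
    (a : ℕ → Ω → Fin M × Fin M) (y : ℕ → Ω → Bool) (L : ℕ) (ω : Ω) : Param M d :=
  (√(L : ℝ))⁻¹ • scoreVec (fun l => design (x l) (a l ω)) (response fun l => y l ω) L βstar

omit [MeasurableSpace Ω] in
lemma inner_normalizedScore (v : Param M d) (L : ℕ) (ω : Ω) :
    (inner ℝ v (normalizedScore x βstar a y L ω) : ℝ) = (√(L : ℝ))⁻¹ *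
      ∑ l ∈ Finset.range L, ((if y l ω then 1 else 0) -
        Real.sigmoid (inner ℝ βstar (design (x l) (a l ω)))) * inner ℝ v (design (x l) (a l ω)) := by
  rw [normalizedScore, real_inner_smul_right, ← logisticScore_eq_inner]
  rfl

lemma norm_le_sum_abs {n : Type*} [Fintype n] (u : EuclideanSpace ℝ n) : ‖u‖ ≤ ∑ i, |u i| := by
  classical
  calc ‖u‖ = ‖∑ i, u i • EuclideanSpace.single i (1 : ℝ)‖ := by
        congr 1
        ext j
        simp [Finset.sum_apply, Pi.single_apply]
    _ ≤ ∑ i, ‖u i • EuclideanSpace.single i (1 : ℝ)‖ := norm_sum_le _ _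
    _ = _ := by simp [norm_smul]

namespace IsBTLSample

lemma ae_norm_design_le (h : IsBTLSample P x p βstar a y)
    (hK : ∀ l c, 0 < p c → ‖design (x l) c‖ ≤ K) :
    ∀ᵐ ω ∂P, ∀ l, ‖design (x l) (a l ω)‖ ≤ K := by
  filter_upwards [h.ae_pair_prob_pos] with ω hω l
  exact hK l _ (hω l)

lemma ae_abs_score_le (h : IsBTLSample P x p βstar a y)
    (hK : ∀ l c, 0 < p c → ‖design (x l) c‖ ≤ K) (v : Param M d) (l : ℕ) :
    ∀ᵐ ω ∂P, |((if y l ω then (1 : ℝ) else 0) -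
        Real.sigmoid (inner ℝ βstar (design (x l) (a l ω)))) * inner ℝ v (design (x l) (a l ω))| ≤
      ‖v‖ * K := by
  filter_upwards [h.ae_norm_design_le hK] with ω hω
  rw [abs_mul]
  calc _ ≤ 1 * (‖v‖ * K) := by
        refine mul_le_mul (abs_response_sub_sigmoid_le (fun l => y l ω) l _) ?_ (abs_nonneg _)
          zero_le_one
        exact (abs_real_inner_le_norm _ _).trans
          (mul_le_mul_of_nonneg_left (hω l) (norm_nonneg v))
    _ = _ := one_mul _

lemma integral_score (h : IsBTLSample P x p βstar a y) (v : Param M d) (l : ℕ) :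
    ∫ ω, ((if y l ω then (1 : ℝ) else 0) -
      Real.sigmoid (inner ℝ βstar (design (x l) (a l ω)))) *
        inner ℝ v (design (x l) (a l ω)) ∂P = 0 := by
  rw [h.integral_eq l fun c z => ((if z then (1 : ℝ) else 0) -
    Real.sigmoid (inner ℝ βstar (design (x l) c))) * inner ℝ v (design (x l) c)]
  refine Finset.sum_eq_zero fun c _ => ?_
  simp only [if_true, Bool.false_eq_true, if_false]
  ring

lemma integral_score_sq (h : IsBTLSample P x p βstar a y) (v : Param M d) (l : ℕ) :
    ∫ ω, (((if y l ω then (1 : ℝ) else 0) -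
      Real.sigmoid (inner ℝ βstar (design (x l) (a l ω)))) *
        inner ℝ v (design (x l) (a l ω))) ^ 2 ∂P =
      ∑ c, p c * (sigmoidDeriv (inner ℝ βstar (design (x l) c)) *
        (inner ℝ v (design (x l) c)) ^ 2) := by
  rw [h.integral_eq l fun c z => (((if z then (1 : ℝ) else 0) -
    Real.sigmoid (inner ℝ βstar (design (x l) c))) * inner ℝ v (design (x l) c)) ^ 2]
  refine Finset.sum_congr rfl fun c _ => ?_
  simp only [if_true, Bool.false_eq_true, if_false, sigmoidDeriv]
  ring

omit [IsProbabilityMeasure P] in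
lemma aemeasurable_score (h : IsBTLSample P x p βstar a y) (v : Param M d) (l : ℕ) :
    AEMeasurable (fun ω => ((if y l ω then (1 : ℝ) else 0) -
      Real.sigmoid (inner ℝ βstar (design (x l) (a l ω)))) *
        inner ℝ v (design (x l) (a l ω))) P :=
  h.aemeasurable_comp l fun c z => ((if z then (1 : ℝ) else 0) -
    Real.sigmoid (inner ℝ βstar (design (x l) c))) * inner ℝ v (design (x l) c)

omit [IsProbabilityMeasure P] in
lemma iIndepFun_score (h : IsBTLSample P x p βstar a y) (v : Param M d) :
    iIndepFun (fun l ω => ((if y l ω then (1 : ℝ) else 0) -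
      Real.sigmoid (inner ℝ βstar (design (x l) (a l ω)))) *
        inner ℝ v (design (x l) (a l ω))) P :=
  h.iIndepFun_comp fun l c z => ((if z then (1 : ℝ) else 0) -
    Real.sigmoid (inner ℝ βstar (design (x l) c))) * inner ℝ v (design (x l) c)

omit [IsProbabilityMeasure P] in
lemma aemeasurable_normalizedScore (h : IsBTLSample P x p βstar a y) (L : ℕ) :
    AEMeasurable (normalizedScore x βstar a y L) P := by
  have hm : Measurable (normalizedScore x βstar a y L) := by
    unfold normalizedScore scoreVec
    have hterm : ∀ l, Measurable fun ω => (response (fun l => y l ω) l -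
        Real.sigmoid (inner ℝ βstar (design (x l) (a l ω)))) • design (x l) (a l ω) := fun l =>
      (measurable_of_finite fun t : (Fin M × Fin M) × Bool =>
        (((if t.2 then (1 : ℝ) else 0) - Real.sigmoid (inner ℝ βstar (design (x l) t.1))) •
          design (x l) t.1 : Param M d)).comp
        ((h.measurable_pair l).prodMk (h.measurable_outcome l))
    have hsum := Finset.measurable_fun_sum (Finset.range L) fun l _ => hterm l
    exact hsum.const_smul (√(L : ℝ))⁻¹
  exact hm.aemeasurable

/-- A norm above `R` forces some coordinate above `R / N`. Chebyshev's inequality for each of the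
`N` coordinates and a union bound give the factor `N³`. -/
lemma measure_lt_norm_normalizedScore_le (h : IsBTLSample P x p βstar a y) (hM : M ≠ 0)
    (hK : ∀ l c, 0 < p c → ‖design (x l) c‖ ≤ K) {R : ℝ} (hR : 0 < R) {L : ℕ} (hL : 0 < L) :
    P {ω | R < ‖normalizedScore x βstar a y L ω‖} ≤
      ENNReal.ofReal ((Fintype.card (Idx M d) : ℝ) ^ 3 * K ^ 2 / R ^ 2) := by
  set N : ℝ := (Fintype.card (Idx M d) : ℝ)
  have hLpos : (0 : ℝ) < L := by exact_mod_cast hL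
  have hs : 0 < √(L : ℝ) := Real.sqrt_pos.2 hLpos
  have hN : 0 < N := by
    have : Nonempty (Idx M d) := ⟨Sum.inl ⟨0, Nat.pos_of_ne_zero hM⟩⟩
    simp only [N]
    exact_mod_cast Fintype.card_pos
  have hc : 0 < √(L : ℝ) * (R / N) := by positivity
  have hcover : {ω | R < ‖normalizedScore x βstar a y L ω‖} ⊆
      ⋃ i : Idx M d, {ω | √(L : ℝ) * (R / N) ≤ |∑ l ∈ Finset.range L,
        ((if y l ω then (1 : ℝ) else 0) - Real.sigmoid (inner ℝ βstar (design (x l) (a l ω)))) *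
          inner ℝ (EuclideanSpace.single i (1 : ℝ)) (design (x l) (a l ω)) -
        ∑ l ∈ Finset.range L, ∫ ω, ((if y l ω then (1 : ℝ) else 0) -
          Real.sigmoid (inner ℝ βstar (design (x l) (a l ω)))) *
          inner ℝ (EuclideanSpace.single i (1 : ℝ)) (design (x l) (a l ω)) ∂P|} := by
    intro ω hω
    by_contra hnot
    simp only [Set.mem_iUnion, not_exists, Set.mem_ofPred_eq, not_le] at hnot
    refine (Set.mem_ofPred_eq ▸ hω : R < _).not_ge ?_
    set U := normalizedScore x βstar a y L ω with hU
    have hcoord : ∀ i, |U i| ≤ R / N := by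
      intro i
      have hi := hnot i
      rw [Finset.sum_eq_zero fun l _ => h.integral_score _ l, sub_zero] at hi
      have hUi : U i = inner ℝ (EuclideanSpace.single i (1 : ℝ)) U := by
        rw [EuclideanSpace.inner_single_left, map_one, one_mul]
      rw [hUi, hU, inner_normalizedScore, abs_mul, abs_of_pos (inv_pos.2 hs), ← div_eq_inv_mul,
        div_le_iff₀ hs]
      linarith
    calc ‖U‖ ≤ ∑ i, |U i| := norm_le_sum_abs U
      _ ≤ ∑ _i : Idx M d, R / N := Finset.sum_le_sum fun i _ => hcoord i
      _ = R := by
          rw [Finset.sum_const, Finset.card_univ, nsmul_eq_mul]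
          exact mul_div_cancel₀ R hN.ne'
  refine (measure_mono hcover).trans ((measure_iUnion_fintype_le P _).trans ?_)
  refine (Finset.sum_le_sum fun i _ => measure_abs_sum_sub_integral_ge_le
    (fun l => h.aemeasurable_score (EuclideanSpace.single i (1 : ℝ)) l)
    (h.iIndepFun_score _) (fun l => h.ae_abs_score_le hK _ l) L hc).trans ?_
  have hsq : (√(L : ℝ)) ^ 2 = L := Real.sq_sqrt hLpos.le
  simp only [PiLp.norm_single, norm_one, one_mul, Finset.sum_const, Finset.card_univ,
    nsmul_eq_mul]
  rw [← ENNReal.ofReal_natCast, ← ENNReal.ofReal_mul (by positivity)]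
  refine ENNReal.ofReal_le_ofReal (le_of_eq ?_)
  rw [mul_pow, hsq]
  change N * _ = _
  field_simp

/-- Each entry of the observed information is a sum of independent terms bounded by `K²` whose mean
is the Fisher entry, so Chebyshev's inequality and a union bound over entries apply. -/
lemma measure_hessMatrix_sub_ge_le (h : IsBTLSample P x p βstar a y)
    (hK : ∀ l c, 0 < p c → ‖design (x l) c‖ ≤ K) {δ : ℝ} (hδ : 0 < δ) {L : ℕ} (hL : 0 < L) :
    P (⋃ i, ⋃ j, {ω | δ ≤ |((L : ℝ)⁻¹ • hessMatrix (fun l => design (x l) (a l ω)) L βstar -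
        (L : ℝ)⁻¹ • fisherInfo x p L βstar) i j|}) ≤
      ENNReal.ofReal ((Fintype.card (Idx M d) : ℝ) ^ 2 * K ^ 4 / δ ^ 2 * (L : ℝ)⁻¹) := by
  have hLpos : (0 : ℝ) < L := by exact_mod_cast hL
  have hentry : ∀ i j : Idx M d,
      P {ω | δ ≤ |((L : ℝ)⁻¹ • hessMatrix (fun l => design (x l) (a l ω)) L βstar -
        (L : ℝ)⁻¹ • fisherInfo x p L βstar) i j|} ≤
      ENNReal.ofReal (K ^ 4 / δ ^ 2 * (L : ℝ)⁻¹) := by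
    intro i j
    set F : ℕ → Fin M × Fin M → Bool → ℝ := fun l c _ =>
      sigmoidDeriv (inner ℝ βstar (design (x l) c)) * (design (x l) c i * design (x l) c j)
    have hmean : ∀ l, ∫ ω, F l (a l ω) (y l ω) ∂P = ∑ c, p c *
        (sigmoidDeriv (inner ℝ βstar (design (x l) c)) * (design (x l) c i * design (x l) c j)) := by
      intro l
      rw [h.integral_eq l (F l)]
      refine Finset.sum_congr rfl fun c _ => ?_
      simp only [F]
      ring
    have hbound : ∀ l, ∀ᵐ ω ∂P, |F l (a l ω) (y l ω)| ≤ K ^ 2 := by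
      intro l
      filter_upwards [h.ae_norm_design_le hK] with ω hω
      have hi : |design (x l) (a l ω) i| ≤ K := (PiLp.norm_apply_le _ i).trans (hω l)
      have hj : |design (x l) (a l ω) j| ≤ K := (PiLp.norm_apply_le _ j).trans (hω l)
      have hK0 : 0 ≤ K := (abs_nonneg _).trans hi
      rw [abs_mul, abs_mul, abs_of_pos (sigmoidDeriv_pos _)]
      calc _ ≤ 1 * (K * K) := by
            gcongr
            exact sigmoidDeriv_le_one _
        _ = _ := by ring
    have hc : 0 < (L : ℝ) * δ := by positivity
    refine (measure_mono fun ω hω => ?_).trans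
      ((measure_abs_sum_sub_integral_ge_le (fun l => h.aemeasurable_comp l (F l))
        (h.iIndepFun_comp F) hbound L hc).trans (ENNReal.ofReal_le_ofReal (le_of_eq ?_)))
    · simp only [Set.mem_ofPred_eq] at hω ⊢
      rw [← smul_sub, Matrix.smul_apply, smul_eq_mul, abs_mul, abs_of_pos (inv_pos.2 hLpos),
        ← div_eq_inv_mul, le_div_iff₀ hLpos, Matrix.sub_apply, fisherInfo_apply] at hω
      simp_rw [hmean]
      rw [mul_comm]
      exact hω
    · field_simp
  refine (measure_iUnion_fintype_le P _).trans ((Finset.sum_le_sum fun i _ =>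
    (measure_iUnion_fintype_le P _).trans (Finset.sum_le_sum fun j _ => hentry i j)).trans ?_)
  simp only [Finset.sum_const, Finset.card_univ, nsmul_eq_mul]
  rw [← ENNReal.ofReal_natCast, ← ENNReal.ofReal_mul (by positivity),
    ← ENNReal.ofReal_mul (by positivity)]
  refine ENNReal.ofReal_le_ofReal (le_of_eq ?_)
  ring

variable {Ibar : Matrix (Idx M d) (Idx M d) ℝ}

/-- Outside an event of small probability the normalized score is bounded and the normalized
observed information is close to its limit. -/
lemma exists_eventually_measure_bad_le (h : IsBTLSample P x p βstar a y) (hM : M ≠ 0)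
    (hK : ∀ l c, 0 < p c → ‖design (x l) c‖ ≤ K)
    (hfisher : Tendsto (fun L : ℕ => (L : ℝ)⁻¹ • fisherInfo x p L βstar) atTop (𝓝 Ibar))
    {τ : ℝ} (hτ : 0 < τ) :
    ∃ R > 0, ∀ δ > 0, ∀ᶠ L : ℕ in atTop,
      P {ω | ¬ (‖normalizedScore x βstar a y L ω‖ ≤ R ∧ ∀ i j,
        |((L : ℝ)⁻¹ • hessMatrix (fun l => design (x l) (a l ω)) L βstar - Ibar) i j| ≤ δ)} ≤
        ENNReal.ofReal τ := by
  set N : ℝ := (Fintype.card (Idx M d) : ℝ)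
  have hlimR : Tendsto (fun R : ℝ => N ^ 3 * K ^ 2 / R ^ 2) atTop (𝓝 0) :=
    tendsto_const_nhds.div_atTop (tendsto_pow_atTop two_ne_zero)
  -- `R` depends on `τ` alone and is fixed before `δ`, so that `δ` may later be chosen in terms of
  -- `R`.
  obtain ⟨R, hRτ, hR⟩ := ((hlimR.eventually_lt_const (half_pos hτ)).and
    (eventually_gt_atTop 0)).exists
  refine ⟨R, hR, fun δ hδ => ?_⟩
  have hlimL : Tendsto (fun L : ℕ => N ^ 2 * K ^ 4 / (δ / 2) ^ 2 * (L : ℝ)⁻¹) atTop (𝓝 0) := by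
    have h0 : Tendsto (fun L : ℕ => (L : ℝ)⁻¹) atTop (𝓝 0) :=
      tendsto_inv_atTop_zero.comp tendsto_natCast_atTop_atTop
    have h1 := h0.const_mul (N ^ 2 * K ^ 4 / (δ / 2) ^ 2)
    rwa [mul_zero] at h1
  filter_upwards [hlimL.eventually_lt_const (half_pos hτ), eventually_gt_atTop 0,
    eventually_abs_fisherInfo_sub_le hfisher (half_pos hδ)] with L hLτ hL0 hLδ
  have hcover : {ω | ¬ (‖normalizedScore x βstar a y L ω‖ ≤ R ∧ ∀ i j,
        |((L : ℝ)⁻¹ • hessMatrix (fun l => design (x l) (a l ω)) L βstar - Ibar) i j| ≤ δ)} ⊆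
      {ω | R < ‖normalizedScore x βstar a y L ω‖} ∪
      ⋃ i, ⋃ j, {ω | δ / 2 ≤ |((L : ℝ)⁻¹ • hessMatrix (fun l => design (x l) (a l ω)) L βstar -
        (L : ℝ)⁻¹ • fisherInfo x p L βstar) i j|} := by
    intro ω hω
    by_contra hnot
    simp only [Set.mem_union, Set.mem_iUnion, Set.mem_ofPred_eq, not_or, not_exists, not_lt,
      not_le] at hnot
    refine hω ⟨hnot.1, fun i j => ?_⟩
    have h1 := hnot.2 i j
    have h2 := hLδ i j
    have h3 : ((L : ℝ)⁻¹ • hessMatrix (fun l => design (x l) (a l ω)) L βstar - Ibar) i j =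
        ((L : ℝ)⁻¹ • hessMatrix (fun l => design (x l) (a l ω)) L βstar -
          (L : ℝ)⁻¹ • fisherInfo x p L βstar) i j +
        ((L : ℝ)⁻¹ • fisherInfo x p L βstar - Ibar) i j := by
      simp only [Matrix.sub_apply]
      ring
    rw [h3]
    exact (abs_add_le _ _).trans (by linarith)
  refine (measure_mono hcover).trans ((measure_union_le _ _).trans ((add_le_add
    (h.measure_lt_norm_normalizedScore_le hM hK hR hL0)
    (h.measure_hessMatrix_sub_ge_le hK (half_pos hδ) hL0)).trans ?_))
  have hK2 : 0 ≤ N ^ 3 * K ^ 2 / R ^ 2 := by positivity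
  rw [← ENNReal.ofReal_add hK2 (by positivity)]
  exact ENNReal.ofReal_le_ofReal (by linarith)

/-- The central limit theorem for the score. -/
lemma tendstoInDistribution_mulVec_normalizedScore (h : IsBTLSample P x p βstar a y)
    (hK : ∀ l c, 0 < p c → ‖design (x l) c‖ ≤ K)
    (hfisher : Tendsto (fun L : ℕ => (L : ℝ)⁻¹ • fisherInfo x p L βstar) atTop (𝓝 Ibar))
    {S : Matrix (Idx M d) (Idx M d) ℝ} (hS : S.PosSemidef) (hSIS : S * Ibar * S = S) :
    TendstoInDistribution (fun (L : ℕ) ω =>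
      Matrix.toEuclideanCLM (𝕜 := ℝ) S (normalizedScore x βstar a y L ω)) atTop
      (id : Param M d → Param M d) (fun _ => P) (multivariateGaussian 0 S) := by
  set T := Matrix.toEuclideanCLM (𝕜 := ℝ) S
  have hT : ∀ u : Param M d, T u = WithLp.toLp 2 (S *ᵥ u.ofLp) := fun u => rfl
  have hST : Sᵀ = S := by
    have := hS.1
    rwa [Matrix.IsHermitian, Matrix.conjTranspose_eq_transpose_of_trivial] at this
  have hmeas : ∀ L, AEMeasurable (fun ω => T (normalizedScore x βstar a y L ω)) P := fun L =>
    T.continuous.measurable.comp_aemeasurable (h.aemeasurable_normalizedScore L)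
  refine ⟨hmeas, aemeasurable_id, ?_⟩
  refine ProbabilityMeasure.tendsto_iff_tendsto_charFun.2 fun t => ?_
  simp only [ProbabilityMeasure.coe_mk, Measure.map_id]
  -- The limiting variance in direction `t` is `tᵀ S Ibar S t`, which `hSIS` collapses to the
  -- Gaussian one.
  have hquad : (T t).ofLp ⬝ᵥ (Ibar *ᵥ (T t).ofLp) = t.ofLp ⬝ᵥ (S *ᵥ t.ofLp) := by
    rw [hT]
    simp only
    nth_rewrite 3 [← hSIS]
    rw [← Matrix.mulVec_mulVec, ← Matrix.mulVec_mulVec, Matrix.dotProduct_mulVec t.ofLp S,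
      ← Matrix.mulVec_transpose, hST]
  have hlim : Tendsto (fun L : ℕ => (L : ℝ)⁻¹ * ∑ l ∈ Finset.range L,
      ∫ ω, (((if y l ω then (1 : ℝ) else 0) -
        Real.sigmoid (inner ℝ βstar (design (x l) (a l ω)))) *
          inner ℝ (T t) (design (x l) (a l ω))) ^ 2 ∂P) atTop
      (𝓝 (t.ofLp ⬝ᵥ (S *ᵥ t.ofLp))) := by
    simp_rw [h.integral_score_sq, ← dotProduct_fisherInfo_mulVec]
    rw [← hquad]
    have hc : Continuous fun B : Matrix (Idx M d) (Idx M d) ℝ =>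
        (T t).ofLp ⬝ᵥ (B *ᵥ (T t).ofLp) :=
      continuous_const.dotProduct (continuous_id.matrix_mulVec continuous_const)
    refine ((hc.tendsto _).comp hfisher).congr fun L => ?_
    simp [Function.comp, Matrix.smul_mulVec]
  have hclt := tendsto_charFun_inv_sqrt_mul_sum_of_bounded
    (fun l => h.aemeasurable_score (T t) l) (h.iIndepFun_score (T t))
    (fun l => h.ae_abs_score_le hK (T t) l) (fun l => h.integral_score (T t) l) hlim
  rw [charFun_multivariateGaussian hS]
  have hval : Complex.exp (((inner ℝ t (0 : Param M d) : ℝ) : ℂ) * Complex.I -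
      ((t.ofLp ⬝ᵥ (S *ᵥ t.ofLp) : ℝ) : ℂ) / 2) =
      Complex.exp (-((t.ofLp ⬝ᵥ (S *ᵥ t.ofLp)) / 2 : ℝ)) := by
    congr 1
    simp
  rw [hval]
  refine hclt.congr fun L => ?_
  -- Cramér–Wold: the characteristic function at `t` is that of a scalar sum at `1`, the direction
  -- being absorbed into the summands through `T t`.
  rw [charFun_apply, charFun_apply, integral_map (hmeas L) (by fun_prop),
    integral_map ((Finset.aemeasurable_fun_sum _ fun l _ =>
      h.aemeasurable_score (T t) l).const_mul _) (by fun_prop)]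
  refine integral_congr_ae (ae_of_all _ fun ω => ?_)
  have hin : (inner ℝ (T (normalizedScore x βstar a y L ω)) t : ℝ) =
      inner ℝ (T t) (normalizedScore x βstar a y L ω) := by
    rw [real_inner_comm, real_inner_eq_dotProduct, real_inner_eq_dotProduct, hT, hT]
    rw [Matrix.dotProduct_mulVec, ← Matrix.mulVec_transpose, hST]
  simp only
  rw [hin, inner_normalizedScore]
  simp

end IsBTLSample

end ContextualBTL

/-! ### Assembly of the theorem. -/

namespace ContextualBTL

lemma tendsto_measure_zero_of_forall_le_ofReal {Ω : Type*} [MeasurableSpace Ω] {P : Measure Ω}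
    {s : ℕ → Set Ω} (h : ∀ τ : ℝ, 0 < τ → ∀ᶠ L : ℕ in atTop, P (s L) ≤ ENNReal.ofReal τ) :
    Tendsto (fun L => P (s L)) atTop (𝓝 0) := by
  refine ENNReal.tendsto_nhds_zero.2 fun τ hτ => ?_
  rcases eq_or_ne τ ⊤ with rfl | hne
  · exact Eventually.of_forall fun _ => le_top
  · filter_upwards [h τ.toReal (ENNReal.toReal_pos hτ.ne' hne)] with L hL
    rwa [ENNReal.ofReal_toReal hne] at hL

end ContextualBTL

theorem theorem1 {M d : ℕ} {Ω : Type*} [MeasurableSpace Ω] (P : Measure Ω)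
    [IsProbabilityMeasure P]
    (x : ℕ → Covariate d) (p : Fin M × Fin M → ℝ) (βstar : Param M d)
    (a : ℕ → Ω → Fin M × Fin M) (y : ℕ → Ω → Bool)
    -- the data follow the contextual BTL model with the normalized true parameter
    (hβstar : βstar ∈ Theta M d)
    (hmodel : IsBTLSample P x p βstar a y)
    -- connected comparison graph
    (hconn : (comparisonGraph p).Connected)
    -- covariate richness
    (hrich : ∀ᵐ ω ∂P, ∀ᶠ L : ℕ in atTop,
      FullColumnRankOnTheta (slopeDesignMatrix x (fun l => a l ω) L))
    -- bounded design vectors and utilities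
    (hdesign : ∃ B : ℝ, ∀ l c, 0 < p c → ‖design (x l) c‖ < B)
    (hutility : ∃ B : ℝ, ∀ l c, 0 < p c → |inner ℝ βstar (design (x l) c)| ≤ B)
    -- convergence of the normalized Fisher information
    (Ibar : Matrix (Idx M d) (Idx M d) ℝ)
    (hfisher : Tendsto (fun L : ℕ => (L : ℝ)⁻¹ • fisherInfo x p L βstar) atTop (𝓝 Ibar))
    (hpos : PosDefOnTheta Ibar)
    -- the estimator: a constrained MLE whenever one exists, arbitrary otherwise
    (βhat : ℕ → Ω → Param M d)
    (hmeas : ∀ L, AEMeasurable (βhat L) P)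
    (hmle : ∀ L, ∀ᵐ ω ∂P,
      (∃ b, IsConstrainedMLE x (fun l => a l ω) (fun l => y l ω) L b) →
        IsConstrainedMLE x (fun l => a l ω) (fun l => y l ω) L (βhat L ω)) :
    -- the true parameter is eventually the unique constrained minimizer of the expected loss
    (∀ᶠ L : ℕ in atTop, ∀ b ∈ Theta M d, b ≠ βstar →
      ∫ ω, negLogLik x (fun l => a l ω) (fun l => y l ω) L βstar ∂P <
        ∫ ω, negLogLik x (fun l => a l ω) (fun l => y l ω) L b ∂P) ∧
    -- a unique constrained MLE exists with probability tending to one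
    Tendsto (fun L : ℕ =>
      P {ω | ∃! b, IsConstrainedMLE x (fun l => a l ω) (fun l => y l ω) L b}) atTop (𝓝 1) ∧
    -- asymptotic normality
    ∃ S : Matrix (Idx M d) (Idx M d) ℝ,
      IsMoorePenroseInverse (projMatrix M d * Ibar * projMatrix M d) S ∧
      TendstoInDistribution (fun (L : ℕ) ω => √(L : ℝ) • (βhat L ω - βstar)) atTop
        (id : Param M d → Param M d) (fun _ => P) (multivariateGaussian 0 S) := by
  classical
  -- Connectedness includes nonemptiness, hence `M ≠ 0`, which makes `C Cᵀ = M • 1` invertible.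
  obtain ⟨m⟩ := hconn.nonempty
  have hM : M ≠ 0 := fun h0 => (Fin.cast h0 m).elim0
  obtain ⟨B, hB⟩ := hdesign
  have hK0 : 0 < max B 1 := lt_max_of_lt_right one_pos
  have hK : ∀ l c, 0 < p c → ‖design (x l) c‖ ≤ max B 1 := fun l c hc =>
    (hB l c hc).le.trans (le_max_left _ _)
  obtain ⟨c, hc, hcoer⟩ := hpos.exists_coercive
  have hIT : Ibarᵀ = Ibar := transpose_eq_of_tendsto_fisherInfo hfisher
  obtain ⟨S, hMP, hSpsd, hSIS, hSmem, hSA⟩ := exists_posSemidef_pseudoinverse hM hIT hpos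
  have hST : Sᵀ = S := by
    have := hSpsd.1
    rwa [Matrix.IsHermitian, Matrix.conjTranspose_eq_transpose_of_trivial] at this
  have hsqrt : Tendsto (fun L : ℕ => √(L : ℝ)) atTop atTop :=
    Real.tendsto_sqrt_atTop.comp tendsto_natCast_atTop_atTop
  set N : ℝ := (Fintype.card (Idx M d) : ℝ) ^ 2
  have hN : 0 < N + 1 := by positivity
  have hexists : ∀ τ : ℝ, 0 < τ → ∀ᶠ L : ℕ in atTop,
      P {ω | ¬ ∃! b, IsConstrainedMLE x (fun l => a l ω) (fun l => y l ω) L b} ≤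
        ENNReal.ofReal τ := by
    intro τ hτ
    obtain ⟨R, hR, hbad⟩ := hmodel.exists_eventually_measure_bad_le hM hK hfisher hτ
    have hδ : 0 < c / (2 * (N + 1)) := by positivity
    filter_upwards [hbad _ hδ, eventually_gt_atTop 0,
      hsqrt.eventually_gt_atTop (8 * R * max B 1 / c)] with L hL hL0 hLs
    refine (measure_mono_ae ?_).trans hL
    filter_upwards [hmodel.ae_norm_design_le hK] with ω hω hnot hgood
    refine hnot ?_
    simp_rw [isConstrainedMLE_iff]
    rw [div_lt_iff₀' hc] at hLs
    refine existsUnique_minimizer_of_close hL0 hK0 hc hβstar hω hcoer hgood.2 ?_ hgood.1 hLs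
    rw [div_mul_eq_mul_div, div_le_iff₀ (by positivity)]
    nlinarith
  refine ⟨eventually_integral_negLogLik_lt hmodel hβstar hfisher hpos, ?_, S, hMP, ?_⟩
  · have hcompl : Tendsto (fun L : ℕ =>
        P {ω | ¬ ∃! b, IsConstrainedMLE x (fun l => a l ω) (fun l => y l ω) L b}) atTop (𝓝 0) :=
      tendsto_measure_zero_of_forall_le_ofReal hexists
    have hlower : Tendsto (fun L : ℕ => 1 -
        P {ω | ¬ ∃! b, IsConstrainedMLE x (fun l => a l ω) (fun l => y l ω) L b}) atTop (𝓝 1) := by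
      simpa using ENNReal.Tendsto.sub tendsto_const_nhds hcompl (Or.inl ENNReal.one_ne_top)
    refine tendsto_of_tendsto_of_tendsto_of_le_of_le hlower tendsto_const_nhds (fun L => ?_)
      fun L => prob_le_one
    -- Subadditivity bounds the probability from below without measurability of the uniqueness
    -- event.
    rw [tsub_le_iff_right, ← measure_univ (μ := P)]
    refine (measure_mono fun ω _ => ?_).trans (measure_union_le _ _)
    exact em _
  · refine tendstoInDistribution_of_tendstoInMeasure_sub _ _
      (hmodel.tendstoInDistribution_mulVec_normalizedScore hK hfisher hSpsd hSIS) ?_ fun L =>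
        ((hmeas L).sub_const βstar).const_smul (√(L : ℝ))
    rw [tendstoInMeasure_iff_norm]
    intro ε hε
    refine tendsto_measure_zero_of_forall_le_ofReal fun τ hτ => ?_
    obtain ⟨R, hR, hbad⟩ := hmodel.exists_eventually_measure_bad_le hM hK hfisher hτ
    set C : ℝ := ‖Matrix.toEuclideanCLM (𝕜 := ℝ) S‖
    have hC : 0 ≤ C := norm_nonneg _
    -- The first condition preserves half of the coercivity; the second gives the information error
    -- one half of `ε`. The Taylor remainder takes the other half through `hsmall`.
    obtain ⟨δ, hδ, hδ1, hδ2⟩ : ∃ δ > 0, δ * N ≤ c / 2 ∧ C * (δ * N * (8 * R / c)) < ε / 2 := by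
      have h1 : Tendsto (fun δ : ℝ => δ * N) (𝓝[>] 0) (𝓝 0) := by
        have : Continuous fun δ : ℝ => δ * N := by fun_prop
        simpa using (this.tendsto 0).mono_left nhdsWithin_le_nhds
      have h2 : Tendsto (fun δ : ℝ => C * (δ * N * (8 * R / c))) (𝓝[>] 0) (𝓝 0) := by
        have : Continuous fun δ : ℝ => C * (δ * N * (8 * R / c)) := by fun_prop
        simpa using (this.tendsto 0).mono_left nhdsWithin_le_nhds
      obtain ⟨δ, ⟨h3, h4⟩, h5⟩ := ((h1.eventually_lt_const (half_pos hc)).and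
        (h2.eventually_lt_const (half_pos hε))).and self_mem_nhdsWithin |>.exists
      exact ⟨δ, h5, h3.le, h4⟩
    have hsmall : Tendsto (fun L : ℕ => C * (max B 1 ^ 3 * (8 * R / c) ^ 2 * (√(L : ℝ))⁻¹)) atTop
        (𝓝 0) := by
      have h0 : Tendsto (fun L : ℕ => (√(L : ℝ))⁻¹) atTop (𝓝 0) :=
        tendsto_inv_atTop_zero.comp hsqrt
      have h1 := (h0.const_mul (max B 1 ^ 3 * (8 * R / c) ^ 2)).const_mul C
      simpa only [mul_zero] using h1
    filter_upwards [hbad _ hδ, eventually_gt_atTop 0,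
      hsqrt.eventually_gt_atTop (8 * R * max B 1 / c), hsmall.eventually_lt_const (half_pos hε)]
      with L hL hL0 hLs hLε
    refine (measure_mono_ae ?_).trans hL
    filter_upwards [hmodel.ae_norm_design_le hK, hmle L] with ω hω hmleω hbig hgood
    rw [div_lt_iff₀' hc] at hLs
    have hex : ∃ b, IsConstrainedMLE x (fun l => a l ω) (fun l => y l ω) L b := by
      simp_rw [isConstrainedMLE_iff]
      exact (existsUnique_minimizer_of_close hL0 hK0 hc hβstar hω hcoer hgood.2 hδ1 hgood.1
        hLs).exists
    obtain ⟨hbmem, hbmin⟩ := isConstrainedMLE_iff.1 (hmleω hex)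
    have hle := norm_sub_pseudoinverse_mulVec_score_le hL0 hK0 hc hβstar hω hcoer (le_of_lt hδ)
      hgood.2 hδ1 hgood.1 hLs hST hSmem hSA hbmem hbmin
    have hlt : ‖√(L : ℝ) • (βhat L ω - βstar) -
        Matrix.toEuclideanCLM (𝕜 := ℝ) S (normalizedScore x βstar a y L ω)‖ < ε := by
      refine hle.trans_lt ?_
      rw [mul_add]
      linarith
    have hbig' : ε ≤ ‖√(L : ℝ) • (βhat L ω - βstar) -
        Matrix.toEuclideanCLM (𝕜 := ℝ) S (normalizedScore x βstar a y L ω) - 0‖ := hbig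
    rw [sub_zero] at hbig'
    exact absurd hlt (not_lt.2 hbig')
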